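/- **Setting.** Let $H$ be a separable complex Hilbert space (inner product linear in the second argument), $J$ a complex conjugation on $H$ (an antiunitary involution), and $Q$ an orthogonal projection commuting with $J$, of finite even rank $2n$, such that $Q^\perp=1-Q$ has infinite rank. *CAR and GAR algebra.* For a Hilbert space $K$ with conjugation $C$, $\mathrm{CAR}(K,C)$ is the C*-algebra generated by operators $B(x)$, linear in $x\in K$, with $B(x)^*=B(Cx)$ and $B(x)B(y)+B(y)B(x)=\langle Cx,y\rangle 1$. Let $H_Q=H\oplus Q^\perp H$, $R_Q(f\oplus h)=(Qf+h)\oplus Q^\perp f$, $J_Q=R_Q(J\oplus Q^\perp J)$. The GAR algebra $\mathfrak G$ is the norm-closed unital subalgebra of $\mathrm{CAR}(H_Q,J_Q)$ generated by all $G(f)=B(f\oplus 0)$, $f\in H$; its Grassmann part $\Lambda$ is the norm-closed unital subalgebra generated by the $G(g)$ with $g\in Q^\perp H$. Let ${}^\star$ be the continuous antilinear anti-automorphism of $\mathfrak G$ with $G(f)^\star=G(Jf)$, and let $\Lambda_0,\Lambda_1$ be the even and odd parts of $\Lambda$ for the parity automorphism $G(f)\mapsto -G(f)$. *Phase space.*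 On $QH\otimes\Lambda$ put $(f\otimes\lambda)^\star=(-1)^{q}\,Jf\otimes\lambda^\star$ for $\lambda\in\Lambda_q$ and $\langle f\otimes\lambda,h\otimes\mu\rangle_Q=\langle f,h\rangle\lambda^\star\mu\in\Lambda$. Let $P_0=QH\otimes\Lambda_1$, let $\Phi(f\otimes\lambda)=G(f)\lambda$ (extended linearly), and for $\xi\in P_0$ let $w(\xi)=\exp\Phi(\xi)$ (Grassmann–Weyl operator) and $\alpha_\xi(A)=w(-\xi)Aw(\xi)$. *G-holomorphic functions and integral.* For $u\in QH$ and $\xi\in P_0$ put $\xi_u=\langle u\otimes 1,\xi\rangle_Q$. For $E=\mathfrak G$ or $E=\Lambda$, a function $P_0\to E$ is G-holomorphic if it is a finite complex linear combination of functions $\xi\mapsto X\xi_{u_1}\cdots\xi_{u_k}$ with $k\ge 0$, $X\in E$, $u_j\in QH$. Let $v$ be an element of the exterior algebra of $QH$ of highest degree (i.e. $v\wedge h=0$ for all $h\in QH$). If $e_1,\dots,e_{2n}$ is an orthonormal basis of $QH$ with $Je_i=e_i$, if $F(\xi)=\sum_{I\subset\{1,\dots,2n\}}F^I\xi_I$ with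 $F^I\in E$, where $\xi_I=\xi_{e_{i_1}}\cdots\xi_{e_{i_k}}$ for $I=\{i_1<\dots<i_k\}$, and if $v=v_N\,e_1\wedge\dots\wedge e_{2n}$, then the Grassmann integral is $\int_Q v(\xi)F(\xi)=v_N F^{\{1,\dots,2n\}}$; it is called well defined if such data exist and all of them give the same value. **Theorem.** Let $v$ be a form of highest degree on $QH$ that is selfadjoint for the antilinear involution $(f_1\wedge\dots\wedge f_k)^\star=Jf_k\wedge\dots\wedge Jf_1$ and normalized, $\langle v,v\rangle=1$, for the Fock inner product $\langle f_1\wedge\dots\wedge f_k,h_1\wedge\dots\wedge h_l\rangle=\delta_{kl}\det(\langle f_i,h_j\rangle)$. Let $A\in\mathfrak G$. Then: 1. for every $\xi\in P_0$ the function $\eta\mapsto\alpha_{-\eta}(A)\,e^{\langle\xi^\star,\eta\rangle_Q}$ is G-holomorphic with values in $\mathfrak G$ and its Grassmann integral is well defined, so that the Fourier transform $$(\mathcal F A)(\xi)=w(-\xi)\int_Q v(\eta)\,\alpha_{-\eta}(A)\,e^{\langle\xi^\star,\eta\rangle_Q}$$ is defined; 2. $\mathcal F A$ takes values in the Grassmann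 part $\Lambda$ and is G-holomorphic with values in $\Lambda$; 3. $\xi\mapsto w(\xi)(\mathcal F A)(\xi)$ is G-holomorphic with values in $\mathfrak G$, its Grassmann integral is well defined, and $$A=\int_Q v(\xi)\,w(\xi)\,(\mathcal F A)(\xi).$$ -/

import Mathlib

open scoped InnerProductSpace ComplexConjugate TensorProduct

noncomputable section

/-! ### Complex conjugations -/

/-- A complex conjugation on a complex Hilbert space: an antiunitary involution. -/
structure ComplexConjugation (K : Type*) [NormedAddCommGroup K] [InnerProductSpace ℂ K] where
  toMap : K →ₗ⋆[ℂ] K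
  involutive : ∀ x, toMap (toMap x) = x
  inner_map : ∀ x y, ⟪toMap x, toMap y⟫_ℂ = ⟪y, x⟫_ℂ

instance {K : Type*} [NormedAddCommGroup K] [InnerProductSpace ℂ K] :
    CoeFun (ComplexConjugation K) (fun _ => K → K) := ⟨fun J => J.toMap⟩

namespace ComplexConjugation

variable {K : Type*} [NormedAddCommGroup K] [InnerProductSpace ℂ K] (J : ComplexConjugation K)

/-- The complex bilinear form `(f, h) ↦ ⟪J f, h⟫`. -/
def bilin : K →ₗ[ℂ] K →ₗ[ℂ] ℂ :=
  LinearMap.mk₂ ℂ (fun f h => ⟪J f, h⟫_ℂ)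
    (fun f g h => by simp)
    (fun c f h => by simp [mul_comm])
    (fun f g h => by simp)
    (fun c f h => by simp)

@[simp] theorem bilin_apply (f h : K) : J.bilin f h = ⟪J f, h⟫_ℂ := rfl

theorem bilin_comm (f h : K) : ⟪J f, h⟫_ℂ = ⟪J h, f⟫_ℂ := by
  have := J.inner_map f (J h)
  rwa [J.involutive] at this

/-- The quadratic form `f ↦ ½ ⟪J f, f⟫`; in its Clifford algebra `B f * B h + B h * B f = ⟪J f, h⟫`. -/
def quadForm : QuadraticForm ℂ K := LinearMap.BilinMap.toQuadraticMap ((1 / 2 : ℂ) • J.bilin)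

theorem quadForm_apply (f : K) : J.quadForm f = (1 / 2) * ⟪J f, f⟫_ℂ := by
  simp [quadForm]

theorem quadForm_conj (f : K) : J.quadForm (J f) = conj (J.quadForm f) := by
  have h2 : conj (2 : ℂ) = 2 := Complex.conj_ofNat 2
  simp [quadForm_apply, J.involutive, h2]

end ComplexConjugation

/-! ### The antilinear anti-automorphism of a Clifford algebra induced by a conjugation -/

/-- The opposite algebra with complex conjugate scalar multiplication. -/
def ConjOpp (A : Type*) : Type _ := Aᵐᵒᵖ

namespace ConjOpp

variable {A : Type*} [Ring A] [Algebra ℂ A]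

instance : Ring (ConjOpp A) := inferInstanceAs (Ring Aᵐᵒᵖ)

instance : Algebra ℂ (ConjOpp A) := Algebra.compHom Aᵐᵒᵖ (starRingEnd ℂ)

/-- The identity map `A → ConjOpp A`. -/
def mk : A →ₗ⋆[ℂ] ConjOpp A where
  toFun a := MulOpposite.op a
  map_add' _ _ := rfl
  map_smul' c a := by
    change MulOpposite.op (c • a) = (starRingEnd ℂ) ((starRingEnd ℂ) c) • MulOpposite.op a
    simp

/-- The identity map `ConjOpp A → A`. -/
def unmk : ConjOpp A →ₗ⋆[ℂ] A where
  toFun a := MulOpposite.unop a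
  map_add' _ _ := rfl
  map_smul' _ _ := rfl

@[simp] theorem unmk_mk (a : A) : unmk (mk a) = a := rfl

theorem unmk_mul (a b : ConjOpp A) : unmk (a * b) = unmk b * unmk a := rfl

theorem mk_mul (a b : A) : mk a * mk b = mk (b * a) := rfl

theorem unmk_algebraMap (c : ℂ) :
    unmk (algebraMap ℂ (ConjOpp A) c) = algebraMap ℂ A (conj c) := rfl

theorem mk_algebraMap (c : ℂ) :
    mk (algebraMap ℂ A (conj c)) = algebraMap ℂ (ConjOpp A) c := rfl

end ConjOpp

section CliffordConj

variable {V : Type*} [AddCommGroup V] [Module ℂ V] (q : QuadraticForm ℂ V) (J : V →ₗ⋆[ℂ] V)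
  (hq : ∀ x, q (J x) = conj (q x))

/-- The antilinear anti-automorphism `f₁ ⋯ fₖ ↦ J fₖ ⋯ J f₁` of a Clifford algebra. -/
def cliffordConj : CliffordAlgebra q →ₗ⋆[ℂ] CliffordAlgebra q :=
  ConjOpp.unmk.comp (CliffordAlgebra.lift q
    ⟨(ConjOpp.mk (A := CliffordAlgebra q)).comp ((CliffordAlgebra.ι q).comp J), fun m => by
      simp only [LinearMap.comp_apply, ConjOpp.mk_mul, CliffordAlgebra.ι_sq_scalar, hq]
      exact ConjOpp.mk_algebraMap _⟩).toLinearMap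

theorem cliffordConj_ι (x : V) :
    cliffordConj q J hq (CliffordAlgebra.ι q x) = CliffordAlgebra.ι q (J x) := by
  simp [cliffordConj]

theorem cliffordConj_mul (a b : CliffordAlgebra q) :
    cliffordConj q J hq (a * b) = cliffordConj q J hq b * cliffordConj q J hq a := by
  simp [cliffordConj, ConjOpp.unmk_mul]

theorem cliffordConj_algebraMap (c : ℂ) :
    cliffordConj q J hq (algebraMap ℂ _ c) = algebraMap ℂ _ (conj c) := by
  simp [cliffordConj, ConjOpp.unmk_algebraMap]

theorem cliffordConj_cliffordConj (hJ : ∀ x, J (J x) = x) (a : CliffordAlgebra q) :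
    cliffordConj q J hq (cliffordConj q J hq a) = a := by
  induction a using CliffordAlgebra.induction with
  | algebraMap r => simp [cliffordConj_algebraMap]
  | ι x => simp [cliffordConj_ι, hJ]
  | mul a b ha hb => simp [cliffordConj_mul, ha, hb]
  | add a b ha hb => simp [ha, hb]

end CliffordConj

/-! ### The selfdual CAR algebra

`CarPoly J` is the `*`-algebra generated by symbols `B f`, linear in `f`, with the relations
`B f * B h + B h * B f = ⟪J f, h⟫` and `(B f)* = B (J f)`. The C*-algebra `CAR J` is its completion
(with null space divided out) in the largest C*-seminorm. -/

/-- A submultiplicative seminorm with the C*-property. -/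
structure IsCStarSeminorm {A : Type*} [Ring A] [Algebra ℂ A] [Star A] (p : Seminorm ℂ A) : Prop where
  mul_le : ∀ x y, p (x * y) ≤ p x * p y
  star_mul_self : ∀ x, p (star x * x) = p x ^ 2

theorem IsCStarSeminorm.star_eq {A : Type*} [Ring A] [Algebra ℂ A] [StarRing A]
    {p : Seminorm ℂ A} (hp : IsCStarSeminorm p) (x : A) : p (star x) = p x := by
  have key : ∀ y : A, p y ≤ p (star y) := fun y => by
    by_contra h
    push Not at h
    have h1 := hp.mul_le (star y) y
    rw [hp.star_mul_self] at h1
    have h0 : 0 ≤ p (star y) := apply_nonneg p _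
    nlinarith
  exact le_antisymm (by simpa using key (star x)) (key x)

section CAR

variable {K : Type*} [NormedAddCommGroup K] [InnerProductSpace ℂ K]

/-- The polynomial selfdual CAR algebra over `(K, J)`. -/
def CarPoly (J : ComplexConjugation K) : Type _ := CliffordAlgebra J.quadForm

namespace CarPoly

variable (J : ComplexConjugation K)

instance : Ring (CarPoly J) := inferInstanceAs (Ring (CliffordAlgebra J.quadForm))

instance : Algebra ℂ (CarPoly J) := inferInstanceAs (Algebra ℂ (CliffordAlgebra J.quadForm))

/-- The Fermi field operators. -/
def B : K →ₗ[ℂ] CarPoly J := CliffordAlgebra.ι J.quadForm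

variable {J}

@[elab_as_elim]
theorem induction {C : CarPoly J → Prop} (algebraMap : ∀ r, C (algebraMap ℂ (CarPoly J) r))
    (B : ∀ x, C (B J x)) (mul : ∀ a b, C a → C b → C (a * b))
    (add : ∀ a b, C a → C b → C (a + b)) (a : CarPoly J) : C a :=
  CliffordAlgebra.induction (Q := J.quadForm) algebraMap B mul add a

theorem B_sq (f : K) : B J f * B J f = algebraMap ℂ (CarPoly J) ((1 / 2) * ⟪J f, f⟫_ℂ) := by
  rw [← J.quadForm_apply]; exact CliffordAlgebra.ι_sq_scalar J.quadForm f

theorem B_anticomm (f h : K) :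
    B J f * B J h + B J h * B J f = algebraMap ℂ (CarPoly J) ⟪J f, h⟫_ℂ := by
  have h1 := B_sq (J := J) (f + h)
  have e : (B J f * B J h + B J h * B J f) =
      B J (f + h) * B J (f + h) - B J f * B J f - B J h * B J h := by
    simp only [map_add]; noncomm_ring
  have e2 : ⟪J (f + h), f + h⟫_ℂ = ⟪J f, f⟫_ℂ + ⟪J h, h⟫_ℂ + 2 * ⟪J f, h⟫_ℂ := by
    simp only [map_add, inner_add_left, inner_add_right, J.bilin_comm h f]; ring
  rw [e, h1, B_sq, B_sq, ← map_sub, ← map_sub, e2]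
  congr 1; ring

instance : StarRing (CarPoly J) where
  star := cliffordConj J.quadForm J.toMap J.quadForm_conj
  star_involutive := cliffordConj_cliffordConj _ _ _ J.involutive
  star_mul := cliffordConj_mul _ _ _
  star_add := map_add _

instance : StarModule ℂ (CarPoly J) where
  star_smul c x := (cliffordConj J.quadForm J.toMap J.quadForm_conj).map_smulₛₗ c x

@[simp] theorem star_B (f : K) : star (B J f) = B J (J f) := cliffordConj_ι _ _ _ f

variable (J) in
/-- The C*-seminorms of the polynomial CAR algebra. -/
def CSemi : Type _ := {p : Seminorm ℂ (CarPoly J) // IsCStarSeminorm p}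

theorem isCStarSeminorm_zero : IsCStarSeminorm (0 : Seminorm ℂ (CarPoly J)) :=
  ⟨by simp, by simp⟩

instance : Nonempty (CSemi J) := ⟨⟨0, isCStarSeminorm_zero⟩⟩

theorem exists_bound (x : CarPoly J) : ∃ M : ℝ, ∀ p : CSemi J, p.1 x ≤ M := by
  have hone : ∀ p : CSemi J, p.1 1 ≤ 1 := fun p => by
    have h := p.2.star_mul_self 1
    rw [star_one, one_mul] at h
    nlinarith [apply_nonneg p.1 (1 : CarPoly J)]
  have halg : ∀ (p : CSemi J) (c : ℂ), p.1 (algebraMap ℂ (CarPoly J) c) ≤ ‖c‖ := fun p c => by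
    rw [Algebra.algebraMap_eq_smul_one, map_smul_eq_mul]
    exact mul_le_of_le_one_right (norm_nonneg _) (hone p)
  induction x using CarPoly.induction with
  | algebraMap r => exact ⟨‖r‖, fun p => halg p r⟩
  | add a b ha hb =>
    obtain ⟨M, hM⟩ := ha
    obtain ⟨N, hN⟩ := hb
    exact ⟨M + N, fun p => (map_add_le_add p.1 a b).trans (add_le_add (hM p) (hN p))⟩
  | mul a b ha hb =>
    obtain ⟨M, hM⟩ := ha
    obtain ⟨N, hN⟩ := hb
    refine ⟨M * N, fun p => (p.2.mul_le a b).trans ?_⟩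
    exact mul_le_mul (hM p) (hN p) (apply_nonneg _ _) ((apply_nonneg p.1 a).trans (hM p))
  | B f =>
    set s : ℂ := ⟪J (J f), f⟫_ℂ
    set c : ℂ := (1 / 2) * ⟪J f, f⟫_ℂ
    set c' : ℂ := (1 / 2) * ⟪J (J f), J f⟫_ℂ
    set y : CarPoly J := B J (J f) * B J f
    refine ⟨‖s‖ + ‖c' * c‖ + 1, fun p => ?_⟩
    have hys : star y = y := by simp [y, J.involutive]
    have hyy : y * y = s • y - algebraMap ℂ (CarPoly J) (c' * c) := by
      have h1 := B_anticomm (J := J) (J f) f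
      have h2 := B_sq (J := J) f
      have h3 := B_sq (J := J) (J f)
      have h4 : B J f * B J (J f) = algebraMap ℂ (CarPoly J) s - y := by
        rw [← h1]; simp [y]
      calc y * y = B J (J f) * (B J f * B J (J f)) * B J f := by simp only [y, mul_assoc]
        _ = B J (J f) * algebraMap ℂ (CarPoly J) s * B J f - B J (J f) * y * B J f := by
            rw [h4]; noncomm_ring
        _ = s • y - (B J (J f) * B J (J f)) * (B J f * B J f) := by
            congr 1
            · rw [← Algebra.commutes, mul_assoc, Algebra.smul_def]
            · simp only [y, mul_assoc]
        _ = _ := by rw [h2, h3, ← map_mul]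
    have hp1 : p.1 y = p.1 (B J f) ^ 2 := by
      rw [← p.2.star_mul_self, star_B]
    have hp2 : p.1 y ^ 2 ≤ ‖s‖ * p.1 y + ‖c' * c‖ := by
      rw [← p.2.star_mul_self, hys, hyy]
      refine (map_sub_le_add p.1 _ _).trans (add_le_add ?_ (halg p _))
      rw [map_smul_eq_mul]
    have h0 : 0 ≤ p.1 (B J f) := apply_nonneg _ _
    have h1 : 0 ≤ p.1 y := apply_nonneg _ _
    have hs : 0 ≤ ‖s‖ := norm_nonneg _
    have hc : 0 ≤ ‖c' * c‖ := norm_nonneg _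
    have hy : p.1 y ≤ ‖s‖ + ‖c' * c‖ + 1 := by
      by_contra h
      push Not at h
      nlinarith [mul_nonneg h1 hc]
    rcases le_total (p.1 (B J f)) 1 with h | h
    · linarith
    · nlinarith

theorem bddAbove (x : CarPoly J) : BddAbove (Set.range fun p : CSemi J => p.1 x) := by
  obtain ⟨M, hM⟩ := exists_bound x
  exact ⟨M, by rintro _ ⟨p, rfl⟩; exact hM p⟩

variable (J) in
/-- The largest C*-seminorm of the polynomial CAR algebra. -/
def maxNorm : RingSeminorm (CarPoly J) where
  toFun x := ⨆ p : CSemi J, p.1 x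
  map_zero' := by simp
  add_le' x y := ciSup_le fun p => (map_add_le_add p.1 x y).trans
    (add_le_add (le_ciSup (bddAbove x) p) (le_ciSup (bddAbove y) p))
  neg' x := by simp
  mul_le' x y := ciSup_le fun p => (p.2.mul_le x y).trans
    (mul_le_mul (le_ciSup (bddAbove x) p) (le_ciSup (bddAbove y) p) (apply_nonneg _ _)
      (Real.iSup_nonneg fun p => apply_nonneg _ _))

instance : SeminormedRing (CarPoly J) := (maxNorm J).toSeminormedRing

theorem norm_def (x : CarPoly J) : ‖x‖ = ⨆ p : CSemi J, p.1 x := rfl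

theorem le_norm (p : CSemi J) (x : CarPoly J) : p.1 x ≤ ‖x‖ := le_ciSup (bddAbove x) p

theorem norm_le {x : CarPoly J} {M : ℝ} (h : ∀ p : CSemi J, p.1 x ≤ M) : ‖x‖ ≤ M := ciSup_le h

instance : NormedAlgebra ℂ (CarPoly J) where
  norm_smul_le c x := norm_le fun p => by
    rw [map_smul_eq_mul]
    exact mul_le_mul_of_nonneg_left (le_norm p x) (norm_nonneg _)

theorem norm_star (x : CarPoly J) : ‖star x‖ = ‖x‖ := by
  simp only [norm_def]
  exact congrArg _ (funext fun p => p.2.star_eq x)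

theorem norm_mul_self_le (x : CarPoly J) : ‖x‖ * ‖x‖ ≤ ‖star x * x‖ := by
  have h : ‖x‖ ≤ Real.sqrt ‖star x * x‖ := norm_le fun p => Real.le_sqrt_of_sq_le <| by
    rw [← p.2.star_mul_self]; exact le_norm p _
  calc ‖x‖ * ‖x‖ ≤ Real.sqrt ‖star x * x‖ * Real.sqrt ‖star x * x‖ :=
        mul_self_le_mul_self (norm_nonneg _) h
    _ = _ := Real.mul_self_sqrt (norm_nonneg _)

end CarPoly

/-- The selfdual CAR algebra over `(K, J)`. -/
def CAR (J : ComplexConjugation K) : Type _ := UniformSpace.Completion (CarPoly J)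

namespace CAR

open UniformSpace

variable {J : ComplexConjugation K}

instance : NormedRing (CAR J) := inferInstanceAs (NormedRing (Completion (CarPoly J)))

instance : Algebra ℂ (CAR J) := inferInstanceAs (Algebra ℂ (Completion (CarPoly J)))

instance : NormedAlgebra ℂ (CAR J) where
  norm_smul_le c x := norm_smul_le (α := ℂ) (β := Completion (CarPoly J)) c x

instance : CompleteSpace (CAR J) := inferInstanceAs (CompleteSpace (Completion (CarPoly J)))

variable (J) in
/-- The canonical map of the polynomial CAR algebra into its completion. -/
def ofPoly : CarPoly J →ₐ[ℂ] CAR J where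
  __ := (Completion.coeRingHom : CarPoly J →+* Completion (CarPoly J))
  commutes' _ := rfl

@[simp] theorem norm_ofPoly (x : CarPoly J) : ‖ofPoly J x‖ = ‖x‖ := Completion.norm_coe x

theorem continuous_ofPoly : Continuous (ofPoly J) := Completion.continuous_coe _

theorem denseRange_ofPoly : DenseRange (ofPoly J) := Completion.denseRange_coe

variable (J) in
/-- The Fermi field operators. -/
def B : K →ₗ[ℂ] CAR J := (ofPoly J).toLinearMap ∘ₗ CarPoly.B J

theorem B_anticomm (f h : K) : B J f * B J h + B J h * B J f = algebraMap ℂ (CAR J) ⟪J f, h⟫_ℂ := by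
  have := congrArg (ofPoly J) (CarPoly.B_anticomm (J := J) f h)
  simpa [B] using this

theorem uniformContinuous_star : UniformContinuous (star : CarPoly J → CarPoly J) := by
  refine (AddMonoidHomClass.isometry_of_norm (starAddEquiv : CarPoly J ≃+ CarPoly J) ?_).uniformContinuous
  exact CarPoly.norm_star

instance : Star (CAR J) := ⟨Completion.map (star : CarPoly J → CarPoly J)⟩

theorem star_ofPoly (x : CarPoly J) : star (ofPoly J x) = ofPoly J (star x) :=
  Completion.map_coe uniformContinuous_star x

theorem continuous_star' : Continuous (star : CAR J → CAR J) := Completion.continuous_map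

theorem induction_on {p : CAR J → Prop} (a : CAR J) (hp : IsClosed {a | p a})
    (ih : ∀ a, p (ofPoly J a)) : p a := Completion.induction_on a hp ih

theorem induction_on₂ {p : CAR J → CAR J → Prop} (a b : CAR J)
    (hp : IsClosed {x : CAR J × CAR J | p x.1 x.2}) (ih : ∀ a b, p (ofPoly J a) (ofPoly J b)) :
    p a b := Completion.induction_on₂ a b hp ih

instance : StarRing (CAR J) where
  star_involutive x := by
    have := continuous_star' (J := J)
    induction x using CAR.induction_on with
    | hp => exact isClosed_eq (by fun_prop) (by fun_prop)
    | ih a => simp [star_ofPoly]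
  star_mul x y := by
    have := continuous_star' (J := J)
    induction x, y using CAR.induction_on₂ with
    | hp => exact isClosed_eq (by fun_prop) (by fun_prop)
    | ih a b => rw [← map_mul, star_ofPoly, star_mul, map_mul, star_ofPoly, star_ofPoly]
  star_add x y := by
    have := continuous_star' (J := J)
    induction x, y using CAR.induction_on₂ with
    | hp => exact isClosed_eq (by fun_prop) (by fun_prop)
    | ih a b => rw [← map_add, star_ofPoly, star_add, map_add, star_ofPoly, star_ofPoly]

instance : CStarRing (CAR J) where
  norm_mul_self_le x := by
    have := continuous_star' (J := J)
    induction x using CAR.induction_on with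
    | hp => exact isClosed_le (by fun_prop) (by fun_prop)
    | ih a =>
      rw [star_ofPoly, ← map_mul, norm_ofPoly, norm_ofPoly]
      exact CarPoly.norm_mul_self_le a

instance : StarModule ℂ (CAR J) where
  star_smul c x := by
    have := continuous_star' (J := J)
    induction x using CAR.induction_on with
    | hp => exact isClosed_eq (this.comp (continuous_const_smul c)) (this.const_smul (star c))
    | ih a => rw [← map_smul, star_ofPoly, star_smul, map_smul, star_ofPoly]

instance : CStarAlgebra (CAR J) where

@[simp] theorem star_B (f : K) : star (B J f) = B J (J f) := by
  simp [B, star_ofPoly]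

end CAR

section Functoriality

variable {K₁ K₂ : Type*} [NormedAddCommGroup K₁] [InnerProductSpace ℂ K₁]
  [NormedAddCommGroup K₂] [InnerProductSpace ℂ K₂]
  {J₁ : ComplexConjugation K₁} {J₂ : ComplexConjugation K₂}
  (S : K₁ →ₗᵢ[ℂ] K₂) (hS : ∀ x, S (J₁ x) = J₂ (S x))

/-- The homomorphism `B f ↦ B (S f)` of polynomial CAR algebras induced by an isometry `S` that
intertwines the conjugations. -/
def CarPoly.map : CarPoly J₁ →ₐ[ℂ] CarPoly J₂ :=
  CliffordAlgebra.map (Q₁ := J₁.quadForm) (Q₂ := J₂.quadForm)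
    { S.toLinearMap with
      map_app' := fun m => by
        change J₂.quadForm (S m) = _
        rw [J₂.quadForm_apply, J₁.quadForm_apply, ← hS, S.inner_map_map] }

@[simp] theorem CarPoly.map_B (f : K₁) : CarPoly.map S hS (CarPoly.B J₁ f) = CarPoly.B J₂ (S f) :=
  CliffordAlgebra.map_apply_ι _ _

theorem CarPoly.map_star (x : CarPoly J₁) :
    CarPoly.map S hS (star x) = star (CarPoly.map S hS x) := by
  induction x using CarPoly.induction with
  | algebraMap r => simp [Algebra.algebraMap_eq_smul_one]
  | B x => simp [hS]
  | mul a b ha hb => simp [ha, hb]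
  | add a b ha hb => simp [ha, hb]

theorem CarPoly.norm_map_le (x : CarPoly J₁) : ‖CarPoly.map S hS x‖ ≤ ‖x‖ :=
  CarPoly.norm_le fun p =>
    CarPoly.le_norm ⟨p.1.comp (CarPoly.map S hS).toLinearMap,
      ⟨fun x y => by simpa using p.2.mul_le _ _, fun x => by
        simpa [CarPoly.map_star] using p.2.star_mul_self (CarPoly.map S hS x)⟩⟩ x

theorem CarPoly.uniformContinuous_map : UniformContinuous (CarPoly.map S hS) :=
  (AddMonoidHomClass.lipschitz_of_bound (CarPoly.map S hS) 1
    (by simpa using CarPoly.norm_map_le S hS)).uniformContinuous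

/-- The continuous homomorphism `B f ↦ B (S f)` of CAR algebras induced by an isometry `S` that
intertwines the conjugations. -/
def CAR.map : CAR J₁ →ₐ[ℂ] CAR J₂ where
  __ := (UniformSpace.Completion.mapRingHom (CarPoly.map S hS : CarPoly J₁ →+* CarPoly J₂)
    (CarPoly.uniformContinuous_map S hS).continuous :
      UniformSpace.Completion (CarPoly J₁) →+* UniformSpace.Completion (CarPoly J₂))
  commutes' r := by
    refine (UniformSpace.Completion.map_coe (CarPoly.uniformContinuous_map S hS) _).trans ?_
    exact congrArg (CAR.ofPoly J₂) ((CarPoly.map S hS).commutes r)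

theorem CAR.continuous_map : Continuous (CAR.map S hS) := UniformSpace.Completion.continuous_map

theorem CAR.map_ofPoly (x : CarPoly J₁) :
    CAR.map S hS (CAR.ofPoly J₁ x) = CAR.ofPoly J₂ (CarPoly.map S hS x) :=
  UniformSpace.Completion.map_coe (CarPoly.uniformContinuous_map S hS) x

@[simp] theorem CAR.map_B (f : K₁) : CAR.map S hS (CAR.B J₁ f) = CAR.B J₂ (S f) := by
  simp [CAR.B, CAR.map_ofPoly]

end Functoriality

end CAR

/-! ### The GAR algebra -/

/-- A triple `(H, J, Q)`: a complex conjugation `J` and an orthogonal projection `Q` on `H` that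
commute. -/
structure GARTriple (H : Type*) [NormedAddCommGroup H] [InnerProductSpace ℂ H]
    [CompleteSpace H] where
  J : ComplexConjugation H
  Q : H →L[ℂ] H
  isStarProjection : IsStarProjection Q
  comm : ∀ x, J (Q x) = Q (J x)

namespace GARTriple

variable {H : Type*} [NormedAddCommGroup H] [InnerProductSpace ℂ H] [CompleteSpace H]
  (T : GARTriple H)

theorem Q_Q (x : H) : T.Q (T.Q x) = T.Q x :=
  congrArg (fun S : H →L[ℂ] H => S x) T.isStarProjection.isIdempotentElem

theorem inner_Q_left (x y : H) : ⟪T.Q x, y⟫_ℂ = ⟪x, T.Q y⟫_ℂ := by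
  have h := T.isStarProjection.isSelfAdjoint
  rw [ContinuousLinearMap.isSelfAdjoint_iff'] at h
  rw [← ContinuousLinearMap.adjoint_inner_right, h]

/-- The range `Q H`. -/
abbrev QH : Submodule ℂ H := LinearMap.range (T.Q : H →ₗ[ℂ] H)

/-- The range `Q^⊥ H` of the complementary projection `1 - Q`. -/
abbrev QperpH : Submodule ℂ H := LinearMap.ker (T.Q : H →ₗ[ℂ] H)

theorem Q_of_mem {x : H} (hx : x ∈ T.QH) : T.Q x = x := by
  obtain ⟨y, rfl⟩ := hx
  exact T.Q_Q y

/-- The complementary projection `Q^⊥ = 1 - Q`, with values in its range. -/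
def Qperp : H →ₗ[ℂ] T.QperpH :=
  LinearMap.codRestrict _ (LinearMap.id - (T.Q : H →ₗ[ℂ] H)) fun x => by
    simp [T.Q_Q]

@[simp] theorem coe_Qperp (x : H) : (T.Qperp x : H) = x - T.Q x := rfl

@[simp] theorem Q_coe (x : T.QperpH) : T.Q (x : H) = 0 := x.2

theorem J_mem_QH {x : H} (hx : x ∈ T.QH) : T.J x ∈ T.QH := by
  obtain ⟨y, rfl⟩ := hx
  exact ⟨T.J y, (T.comm y).symm⟩

theorem J_mem_QperpH {x : H} (hx : x ∈ T.QperpH) : T.J x ∈ T.QperpH := by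
  have h0 : T.Q x = 0 := hx
  change T.Q (T.J x) = 0
  rw [← T.comm, h0, map_zero]

/-- The conjugation `J` restricted to `Q H`. -/
def JQ : T.QH →ₗ⋆[ℂ] T.QH :=
  (T.J.toMap.comp T.QH.subtype).codRestrict T.QH fun x => T.J_mem_QH x.2

@[simp] theorem coe_JQ (x : T.QH) : (T.JQ x : H) = T.J x := rfl

/-- The Hilbert space `H_Q = H ⊕ Q^⊥ H`. -/
abbrev HQ : Type _ := WithLp 2 (H × T.QperpH)

/-- The element `f ⊕ h` of `H_Q`. -/
def pair (f : H) (h : T.QperpH) : T.HQ := WithLp.toLp 2 (f, h)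

@[simp] theorem fst_pair (f : H) (h : T.QperpH) : (T.pair f h).fst = f := rfl

@[simp] theorem snd_pair (f : H) (h : T.QperpH) : (T.pair f h).snd = h := rfl

theorem inner_HQ (x y : T.HQ) :
    ⟪x, y⟫_ℂ = ⟪x.fst, y.fst⟫_ℂ + ⟪(x.snd : H), (y.snd : H)⟫_ℂ :=
  WithLp.prod_inner_apply x y

theorem HQ_ext {x y : T.HQ} (h₁ : x.fst = y.fst) (h₂ : (x.snd : H) = y.snd) : x = y :=
  WithLp.ofLp_injective 2 (Prod.ext h₁ (Subtype.ext h₂))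

/-- The reflection `R_Q (f ⊕ h) = (Q f + h) ⊕ Q^⊥ f`, as a linear map. -/
def reflectionLinear : T.HQ →ₗ[ℂ] T.HQ where
  toFun x := T.pair (T.Q x.fst + x.snd) (T.Qperp x.fst)
  map_add' x y := by
    apply HQ_ext
    · simp; abel
    · simp
  map_smul' c x := by
    apply HQ_ext
    · simp
    · simp [smul_sub]

theorem inner_reflection (x y : T.HQ) :
    ⟪T.reflectionLinear x, T.reflectionLinear y⟫_ℂ = ⟪x, y⟫_ℂ := by
  have h1 : ∀ (a : H) (b : T.QperpH), ⟪T.Q a, (b : H)⟫_ℂ = 0 := fun a b => by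
    rw [T.inner_Q_left, T.Q_coe, inner_zero_right]
  have h2 : ∀ (a : H) (b : T.QperpH), ⟪(b : H), T.Q a⟫_ℂ = 0 := fun a b => by
    rw [← T.inner_Q_left, T.Q_coe, inner_zero_left]
  have h3 : ⟪x.fst, T.Q y.fst⟫_ℂ = ⟪T.Q x.fst, T.Q y.fst⟫_ℂ := by rw [T.inner_Q_left, T.Q_Q]
  have h4 : ⟪T.Q x.fst, y.fst⟫_ℂ = ⟪T.Q x.fst, T.Q y.fst⟫_ℂ := by rw [T.inner_Q_left, h3]
  simp only [inner_HQ, reflectionLinear, LinearMap.coe_mk, AddHom.coe_mk, fst_pair, snd_pair,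
    coe_Qperp, inner_add_left, inner_add_right, inner_sub_left, inner_sub_right, h1, h2, h3, h4]
  ring

/-- The reflection `R_Q (f ⊕ h) = (Q f + h) ⊕ Q^⊥ f`. -/
def reflection : T.HQ →ₗᵢ[ℂ] T.HQ := T.reflectionLinear.isometryOfInner T.inner_reflection

theorem reflection_apply (x : T.HQ) :
    T.reflection x = T.pair (T.Q x.fst + x.snd) (T.Qperp x.fst) := rfl

theorem reflection_reflection (x : T.HQ) : T.reflection (T.reflection x) = x := by
  apply HQ_ext <;> simp [reflection_apply, T.Q_Q]

/-- The antilinear map `J ⊕ Q^⊥ J` on `H_Q`. -/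
def JJ : T.HQ →ₗ⋆[ℂ] T.HQ where
  toFun x := T.pair (T.J x.fst) ⟨T.J x.snd, T.J_mem_QperpH x.snd.2⟩
  map_add' x y := by apply HQ_ext <;> simp
  map_smul' c x := by apply HQ_ext <;> simp

theorem JJ_apply (x : T.HQ) :
    T.JJ x = T.pair (T.J x.fst) ⟨T.J x.snd, T.J_mem_QperpH x.snd.2⟩ := rfl

theorem reflection_JJ (x : T.HQ) : T.reflection (T.JJ x) = T.JJ (T.reflection x) := by
  apply HQ_ext <;> simp [reflection_apply, JJ_apply, T.comm]

/-- The conjugation `J_Q = R_Q (J ⊕ Q^⊥ J)` on `H_Q`. -/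
def conjHQ : ComplexConjugation T.HQ where
  toMap := T.reflectionLinear.comp T.JJ
  involutive x := by
    change T.reflection (T.JJ (T.reflection (T.JJ x))) = x
    rw [← T.reflection_JJ, T.reflection_reflection]
    apply HQ_ext <;> simp [JJ_apply, T.J.involutive]
  inner_map x y := by
    change ⟪T.reflection (T.JJ x), T.reflection (T.JJ y)⟫_ℂ = _
    rw [LinearIsometry.inner_map_map, inner_HQ, inner_HQ]
    simp [JJ_apply, T.J.inner_map]

theorem conjHQ_apply (x : T.HQ) : T.conjHQ x = T.reflection (T.JJ x) := rfl

/-- The enveloping CAR algebra. -/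
abbrev Env : Type _ := CAR T.conjHQ

/-- The Grassmann-Fermi field operators `G f = B (f ⊕ 0)`. -/
def G : H →ₗ[ℂ] T.Env where
  toFun f := CAR.B T.conjHQ (T.pair f 0)
  map_add' f g := by
    rw [← map_add]; congr 1; apply HQ_ext <;> simp
  map_smul' c f := by
    rw [← map_smul]; congr 1; apply HQ_ext <;> simp

theorem G_anticomm (f h : H) :
    T.G f * T.G h + T.G h * T.G f = algebraMap ℂ T.Env ⟪T.J f, T.Q h⟫_ℂ := by
  change CAR.B T.conjHQ _ * CAR.B T.conjHQ _ + CAR.B T.conjHQ _ * CAR.B T.conjHQ _ = _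
  rw [CAR.B_anticomm, inner_HQ]
  simp [conjHQ_apply, reflection_apply, JJ_apply, T.inner_Q_left]

/-- The GAR algebra: the norm-closed subalgebra generated by all `G f`. -/
def GAR : Subalgebra ℂ T.Env := (Algebra.adjoin ℂ (Set.range T.G)).topologicalClosure

/-- The Grassmann part: the norm-closed subalgebra generated by the `G g` with `g ∈ Q^⊥ H`. -/
def Gr : Subalgebra ℂ T.Env :=
  (Algebra.adjoin ℂ (T.G '' (T.QperpH : Set H))).topologicalClosure

/-- The map `x ↦ -x` on `H_Q`. -/
def negHQ : T.HQ →ₗᵢ[ℂ] T.HQ := (LinearIsometryEquiv.neg ℂ).toLinearIsometry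

theorem negHQ_apply (x : T.HQ) : T.negHQ x = -x := rfl

theorem negHQ_conjHQ (x : T.HQ) : T.negHQ (T.conjHQ x) = T.conjHQ (T.negHQ x) := by
  simp [negHQ_apply]

theorem reflection_conjHQ (x : T.HQ) :
    T.reflection (T.conjHQ x) = T.conjHQ (T.reflection x) := by
  rw [conjHQ_apply, conjHQ_apply, T.reflection_JJ]

/-- The parity automorphism, `B x ↦ -B x`. -/
def parity : T.Env →ₐ[ℂ] T.Env := CAR.map T.negHQ T.negHQ_conjHQ

@[simp] theorem parity_G (f : H) : T.parity (T.G f) = -T.G f := by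
  change CAR.map _ _ (CAR.B _ _) = -CAR.B _ _
  rw [CAR.map_B, negHQ_apply, map_neg]

/-- The automorphism of the enveloping CAR algebra induced by the reflection `R_Q`. -/
def flip : T.Env →ₐ[ℂ] T.Env := CAR.map T.reflection T.reflection_conjHQ

/-- The adjoint `⋆` of the GAR algebra: the continuous antilinear anti-automorphism with
`(G f)⋆ = G (J f)`, obtained as the C*-adjoint followed by the automorphism induced by `R_Q`. -/
def gstar : T.Env →ₗ⋆[ℂ] T.Env where
  toFun x := T.flip (star x)
  map_add' x y := by simp
  map_smul' c x := by simp

theorem gstar_apply (x : T.Env) : T.gstar x = T.flip (star x) := rfl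

@[simp] theorem gstar_G (f : H) : T.gstar (T.G f) = T.G (T.J f) := by
  change CAR.map _ _ (star (CAR.B _ _)) = CAR.B _ _
  rw [CAR.star_B, CAR.map_B]
  congr 1
  rw [conjHQ_apply, T.reflection_reflection]
  apply HQ_ext <;> simp [JJ_apply]

theorem gstar_mul (x y : T.Env) : T.gstar (x * y) = T.gstar y * T.gstar x := by
  simp [gstar_apply]

theorem continuous_gstar : Continuous T.gstar :=
  (CAR.continuous_map _ _).comp CAR.continuous_star'

theorem G_mem_Gr {g : H} (hg : g ∈ T.QperpH) : T.G g ∈ T.Gr :=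
  Subalgebra.le_topologicalClosure _ (Algebra.subset_adjoin ⟨g, hg, rfl⟩)

theorem isClosed_Gr : IsClosed (T.Gr : Set T.Env) := Subalgebra.isClosed_topologicalClosure _

theorem gstar_mem_Gr {x : T.Env} (hx : x ∈ T.Gr) : T.gstar x ∈ T.Gr := by
  have h : ∀ y ∈ Algebra.adjoin ℂ (T.G '' (T.QperpH : Set H)), T.gstar y ∈ T.Gr := fun y hy => by
    induction hy using Algebra.adjoin_induction with
    | mem z hz =>
      obtain ⟨g, hg, rfl⟩ := hz
      rw [gstar_G]
      exact T.G_mem_Gr (T.J_mem_QperpH hg)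
    | algebraMap r =>
      rw [gstar_apply, ← algebraMap_star_comm, AlgHom.commutes]
      exact Subalgebra.algebraMap_mem _ _
    | add a b _ _ ha hb => rw [map_add]; exact add_mem ha hb
    | mul a b _ _ ha hb => rw [gstar_mul]; exact mul_mem hb ha
  exact closure_minimal h (T.isClosed_Gr.preimage T.continuous_gstar) hx

theorem parity_mem_Gr {x : T.Env} (hx : x ∈ T.Gr) : T.parity x ∈ T.Gr := by
  have h : ∀ y ∈ Algebra.adjoin ℂ (T.G '' (T.QperpH : Set H)), T.parity y ∈ T.Gr := fun y hy => by
    induction hy using Algebra.adjoin_induction with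
    | mem z hz =>
      obtain ⟨g, hg, rfl⟩ := hz
      rw [parity_G]
      exact neg_mem (T.G_mem_Gr hg)
    | algebraMap r => rw [AlgHom.commutes]; exact Subalgebra.algebraMap_mem _ _
    | add a b _ _ ha hb => rw [map_add]; exact add_mem ha hb
    | mul a b _ _ ha hb => rw [map_mul]; exact mul_mem ha hb
  exact closure_minimal h (T.isClosed_Gr.preimage (CAR.continuous_map _ _)) hx

/-- The adjoint `⋆` on the Grassmann part. -/
def gstarGr : T.Gr →ₗ⋆[ℂ] T.Gr where
  toFun x := ⟨T.gstar x, T.gstar_mem_Gr x.2⟩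
  map_add' x y := Subtype.ext (by simp)
  map_smul' c x := Subtype.ext (by simp)

/-- The parity automorphism on the Grassmann part. -/
def parityGr : T.Gr →ₗ[ℂ] T.Gr where
  toFun x := ⟨T.parity x, T.parity_mem_Gr x.2⟩
  map_add' x y := Subtype.ext (by simp)
  map_smul' c x := Subtype.ext (by simp)

/-- The odd operators of the Grassmann part. -/
def GrOdd : Submodule ℂ T.Gr := LinearMap.ker (T.parityGr + LinearMap.id)

theorem mem_GrOdd {x : T.Gr} : x ∈ T.GrOdd ↔ T.parity x = -x := by
  rw [GrOdd, LinearMap.mem_ker, Subtype.ext_iff]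
  simp [parityGr, add_eq_zero_iff_eq_neg]

/-! ### Anticommutative phase space -/

/-- The anticommutative phase space `QH ⊗ Gr` for a projection `Q` of finite rank. (In finite rank
the algebraic tensor product is already complete in the projective cross norm.) -/
abbrev Phase : Type _ := T.QH ⊗[ℂ] T.Gr

/-- The even part `QH ⊗ Gr₁` of the phase space. -/
def PhaseEven : Submodule ℂ T.Phase :=
  LinearMap.range (TensorProduct.map LinearMap.id T.GrOdd.subtype :
    T.QH ⊗[ℂ] T.GrOdd →ₗ[ℂ] T.Phase)

/-- The complex conjugation of the phase space: `(f ⊗ λ)⋆ = (-1)^q (J f) ⊗ λ⋆` for `λ` of parity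
`q`. -/
def phaseStar : T.Phase →ₗ⋆[ℂ] T.Phase :=
  TensorProduct.map T.JQ (T.gstarGr.comp T.parityGr)

theorem phaseStar_tmul_of_odd (f : T.QH) {a : T.Gr} (ha : a ∈ T.GrOdd) :
    T.phaseStar (f ⊗ₜ a) = -(T.JQ f ⊗ₜ[ℂ] T.gstarGr a) := by
  have h : T.parityGr a = -a := Subtype.ext (T.mem_GrOdd.1 ha)
  simp [phaseStar, h, TensorProduct.tmul_neg]

/-- The rigging map: `⟨f ⊗ λ, h ⊗ μ⟩ = ⟪f, h⟫ λ⋆ μ`. -/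
def rigging : T.Phase →ₗ⋆[ℂ] T.Phase →ₗ[ℂ] T.Gr :=
  TensorProduct.lift
    (LinearMap.mk₂'ₛₗ (starRingEnd ℂ) (starRingEnd ℂ)
      (fun (f : T.QH) (a : T.Gr) => TensorProduct.lift
        (LinearMap.mk₂ ℂ (fun (h : T.QH) (b : T.Gr) => ⟪f, h⟫_ℂ • (T.gstarGr a * b))
          (fun h h' b => by simp [add_smul])
          (fun c h b => by simp [mul_smul])
          (fun h b b' => by simp [mul_add])
          (fun c h b => by simp [smul_comm c])))
      (fun f f' a => by ext h b; simp [add_smul])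
      (fun c f a => by ext h b; simp [mul_smul, smul_comm (conj c)])
      (fun f a a' => by ext h b; simp [add_mul])
      (fun c f a => by ext h b; simp [smul_comm (conj c)]))

@[simp] theorem rigging_tmul (f h : T.QH) (a b : T.Gr) :
    T.rigging (f ⊗ₜ a) (h ⊗ₜ b) = ⟪f, h⟫_ℂ • (T.gstarGr a * b) := rfl

/-- The Grassmann-Bose field: `Φ (f ⊗ λ) = G f * λ`. -/
def Phi : T.Phase →ₗ[ℂ] T.Env :=
  TensorProduct.lift
    (LinearMap.mk₂ ℂ (fun (f : T.QH) (a : T.Gr) => T.G f * (a : T.Env))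
      (fun f f' a => by simp [add_mul])
      (fun c f a => by simp)
      (fun f a a' => by simp [mul_add])
      (fun c f a => by simp))

@[simp] theorem Phi_tmul (f : T.QH) (a : T.Gr) : T.Phi (f ⊗ₜ a) = T.G f * a := rfl

/-- The Grassmann-Weyl operators `w(ξ) = exp Φ(ξ)`, for even `ξ`. -/
def weyl (ξ : T.PhaseEven) : T.Env := NormedSpace.exp (T.Phi ξ)

/-- Phase space translations `α_ξ(A) = w(-ξ) A w(ξ)`. -/
def translate (ξ : T.PhaseEven) (A : T.Env) : T.Env := T.weyl (-ξ) * A * T.weyl ξ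

/-! ### G-holomorphic functions and the Grassmann integral -/

/-- The `u`-component `ξ_u = ⟨u ⊗ 1, ξ⟩` of a phase space vector. -/
def component (u : T.QH) (ξ : T.PhaseEven) : T.Env := T.rigging (u ⊗ₜ 1) (ξ : T.Phase)

/-- The G-holomorphic functions with values in `E`: linear combinations of the monomial functions
`ξ ↦ X ξ_{u₁} ⋯ ξ_{uₖ}` with `X ∈ E` and `u₁, …, uₖ ∈ QH`. -/
def GHol (E : Subalgebra ℂ T.Env) : Submodule ℂ (T.PhaseEven → T.Env) :=
  Submodule.span ℂ {F | ∃ X ∈ E, ∃ l : List T.QH,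
    F = fun ξ => X * (l.map fun u => T.component u ξ).prod}

/-- The monomial `ξ_I = ξ_{i₁} ⋯ ξ_{iₖ}`, `I = {i₁ < ⋯ < iₖ}`, with respect to a basis of `QH`. -/
def monomial {m : ℕ} (e : Fin m → T.QH) (I : Finset (Fin m)) (ξ : T.PhaseEven) : T.Env :=
  ((I.sort (· ≤ ·)).map fun i => T.component (e i) ξ).prod

/-- `X = v_N F^N`, where `F(ξ) = ∑ F^I ξ_I` is a polynomial representation of `F` with coefficients
in `E`, and `v = v_N e₁ ∧ ⋯ ∧ e_m`, with respect to some real orthonormal basis `e` of `QH`. -/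
def IsIntegralValue (E : Subalgebra ℂ T.Env) (v : ExteriorAlgebra ℂ T.QH)
    (F : T.PhaseEven → T.Env) (X : T.Env) : Prop :=
  ∃ (m : ℕ) (e : OrthonormalBasis (Fin m) ℂ T.QH) (c : Finset (Fin m) → T.Env) (vN : ℂ),
    (∀ i, T.JQ (e i) = e i) ∧ (∀ I, c I ∈ E) ∧ (∀ ξ, F ξ = ∑ I, c I * T.monomial e I ξ) ∧
    v = vN • ExteriorAlgebra.ιMulti ℂ m e ∧ X = vN • c Finset.univ

/-- The function `F` is G-holomorphic with values in `E`, and its Grassmann integral over `v` is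
well defined: it does not depend on the basis or on the polynomial representation. -/
def GrassmannIntegrable (E : Subalgebra ℂ T.Env) (v : ExteriorAlgebra ℂ T.QH)
    (F : T.PhaseEven → T.Env) : Prop :=
  F ∈ T.GHol E ∧ ∃! X, T.IsIntegralValue E v F X

open Classical in
/-- The Grassmann integral `∫_Q v(ξ) F(ξ)`. -/
def grassmannIntegral (E : Subalgebra ℂ T.Env) (v : ExteriorAlgebra ℂ T.QH)
    (F : T.PhaseEven → T.Env) : T.Env :=
  if h : ∃ X, T.IsIntegralValue E v F X then h.choose else 0

/-- The integrand `η ↦ α_{-η}(A) exp ⟨ξ⋆, η⟩` of the Fourier transform of `A` at `ξ`. -/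
def fourierIntegrand (A : T.Env) (ξ η : T.PhaseEven) : T.Env :=
  T.translate (-η) A *
    NormedSpace.exp (T.rigging (T.phaseStar (ξ : T.Phase)) (η : T.Phase) : T.Env)

/-- The Fourier transform `(F A)(ξ) = w(-ξ) ∫_Q v(η) α_{-η}(A) exp ⟨ξ⋆, η⟩`. -/
def fourier (v : ExteriorAlgebra ℂ T.QH) (A : T.Env) (ξ : T.PhaseEven) : T.Env :=
  T.weyl (-ξ) * T.grassmannIntegral T.GAR v (T.fourierIntegrand A ξ)

/-! ### Forms on `QH` -/

/-- A form of highest degree. -/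
def IsTopForm (v : ExteriorAlgebra ℂ T.QH) : Prop := ∀ h : T.QH, v * ExteriorAlgebra.ι ℂ h = 0

/-- The adjoint of forms: `(f₁ ∧ ⋯ ∧ fₖ)⋆ = J fₖ ∧ ⋯ ∧ J f₁`, antilinear. -/
def formStar : ExteriorAlgebra ℂ T.QH →ₗ⋆[ℂ] ExteriorAlgebra ℂ T.QH :=
  cliffordConj 0 T.JQ (by simp)

/-- The complex bilinear form `(f, h) ↦ ⟪J f, h⟫` on `QH`. -/
def bilinQ : T.QH →ₗ[ℂ] Module.Dual ℂ T.QH :=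
  LinearMap.mk₂ ℂ (fun f h => ⟪T.J f, (h : H)⟫_ℂ)
    (fun f g h => by simp)
    (fun c f h => by simp [mul_comm])
    (fun f g h => by simp)
    (fun c f h => by simp)

/-- The homomorphism sending `f` to the annihilation operator of `J f`, the contraction with
`⟪J f, ·⟫`. -/
def annihilate : ExteriorAlgebra ℂ T.QH →ₐ[ℂ] Module.End ℂ (ExteriorAlgebra ℂ T.QH) :=
  ExteriorAlgebra.lift ℂ
    ⟨(CliffordAlgebra.contractLeft (Q := (0 : QuadraticForm ℂ T.QH))).comp T.bilinQ, fun f =>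
      LinearMap.ext fun x => CliffordAlgebra.contractLeft_contractLeft (T.bilinQ f) x⟩

/-- The Fock space inner product of forms, `⟨f₁ ∧ ⋯ ∧ fₖ, h₁ ∧ ⋯ ∧ hₗ⟩ = δ_{kl} det ⟪fᵢ, hⱼ⟫`: the
vacuum component of `a(fₖ) ⋯ a(f₁) (h₁ ∧ ⋯ ∧ hₗ)`. -/
def formInner (a b : ExteriorAlgebra ℂ T.QH) : ℂ :=
  ExteriorAlgebra.algebraMapInv (T.annihilate (T.formStar a) b)

theorem formInner_one (b : ExteriorAlgebra ℂ T.QH) :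
    T.formInner 1 b = ExteriorAlgebra.algebraMapInv b := by
  have h : T.formStar 1 = 1 := by
    simpa [formStar] using cliffordConj_algebraMap (0 : QuadraticForm ℂ T.QH) T.JQ (by simp) 1
  simp [formInner, h]

theorem formInner_ι_mul (f : T.QH) (a b : ExteriorAlgebra ℂ T.QH) :
    T.formInner (ExteriorAlgebra.ι ℂ f * a) b =
      T.formInner a (CliffordAlgebra.contractLeft (innerSL ℂ f).toLinearMap b) := by
  have h1 : T.formStar (ExteriorAlgebra.ι ℂ f * a) =
      T.formStar a * ExteriorAlgebra.ι ℂ (T.JQ f) := by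
    rw [formStar, cliffordConj_mul]
    congr 1
    exact cliffordConj_ι _ _ _ f
  have h2 : T.bilinQ (T.JQ f) = (innerSL ℂ f).toLinearMap := by
    ext h
    simp [bilinQ, T.J.involutive]
  rw [formInner, formInner, h1, map_mul, Module.End.mul_apply, ← h2]
  simp [annihilate]

end GARTriple
end

/-! ### Products in noncommutative rings -/

/-! Fix a real orthonormal basis `e` of `QH` and write `G_i = G (e i)`, `ξ_i = component (e i) ξ`,
with `p` the parity. The `ξ_i` are odd elements of `Gr`, so they commute in the graded sense with
all of `GAR`. Hence the summands `G_i ξ_i` of `Phi ξ` commute and square to zero, and every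
exponential is a finite product: `w(ξ) = ∏ (1 + G_i ξ_i)` (`weyl_eq_prod`), while `exp ⟨ξ⋆, η⟩ = ∏
(1 - ξ_i η_i)`.

Consequently the Fourier integrand arises from `A` by composing the operators `X ↦ X + (D_i X) η_i`,
where `d_i X = G_i p(X) - X G_i` is an antiderivation and `D_i X = d_i X - X ξ_i`
(`fourierIntegrand_eq`). Its top coefficient in `η` is `D_1 ⋯ D_{2n} A`. Since `(G_i + ξ_i) w(-ξ) =
w(-ξ) G_i`, multiplication by `w(-ξ)` absorbs the shifts: `(D_1 ⋯ D_{2n} A) w(-ξ) = d_1 ⋯ d_{2n} (A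
w(-ξ))` (`prod_shiftedTwist_mul_weyl_neg`). Each `d_i` differentiates away the generator `G_i`, so
the right side lies in `Gr` (`twists_mem_Gr`) and commutes with `w(ξ)`. Thus, for `v = r e_1 ∧ ⋯ ∧
e_{2n}`, the Fourier transform is `r d_1 ⋯ d_{2n} (A w(-ξ))`, which is visibly G-holomorphic and
`Gr`-valued.

For the inversion, `w(ξ) (F A)(ξ) = r D_1 ⋯ D_{2n} A`, now read as a polynomial in `ξ`. Its top
coefficient picks `-X ξ_i` from every `D_i` and equals `(-1)^n r A` (`exists_inverse_expansion`).
Integration contributes another `r`, and selfadjointness and normalization force `r² = (-1)^n`.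

The integral is well defined for two reasons. Scaling `ξ` isolates the part of top degree, and an
element of `GAR` annihilated by all products of `2n` Grassmann generators vanishes because `Q^⊥ H`
is infinite dimensional (`eq_zero_of_mul_G_eq_zero`). Different bases are compared by substituting
`ξ` into the one form `v`. -/

theorem List.prod_reverse_of_anticomm {R : Type*} [Ring R] (l : List R)
    (h : ∀ a ∈ l, ∀ b ∈ l, a * b + b * a = 0) :
    l.reverse.prod = (-1) ^ (∑ k ∈ Finset.range l.length, k) * l.prod := by
  -- Moving one element past a product of `k` others costs `(-1)^k`; reversal does this once for
  -- each element of the list.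
  have key : ∀ (a : R) (t : List R), (∀ b ∈ t, a * b + b * a = 0) →
      t.prod * a = (-1) ^ t.length * (a * t.prod) := fun a t => by
    induction t with
    | nil => simp
    | cons b t ih =>
      intro ht
      have hb : b * a = -(a * b) := eq_neg_of_add_eq_zero_right (ht b (by simp))
      rw [List.prod_cons, mul_assoc, ih fun c hc => ht c (List.mem_cons_of_mem _ hc),
        ← mul_assoc b, ← ((Commute.neg_one_left b).pow_left t.length).eq, mul_assoc, ← mul_assoc b a,
        hb, List.length_cons, pow_succ]
      simp [mul_assoc]
  induction l with
  | nil => simp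
  | cons a l ih =>
    rw [List.reverse_cons, List.prod_append, List.prod_singleton,
      ih fun b hb c hc => h b (List.mem_cons_of_mem _ hb) c (List.mem_cons_of_mem _ hc),
      mul_assoc, key a l fun b hb => h a (by simp) b (List.mem_cons_of_mem _ hb),
      List.length_cons, Finset.sum_range_succ, pow_add, List.prod_cons, mul_assoc]

/-- The exponent is `n(2n - 1)`, which has the parity of `n`. -/
theorem neg_one_pow_sum_range_two_mul {R : Type*} [Ring R] (n : ℕ) :
    (-1 : R) ^ (∑ k ∈ Finset.range (2 * n), k) = (-1) ^ n := by
  induction n with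
  | zero => simp
  | succ n ih =>
    rw [show 2 * (n + 1) = 2 * n + 1 + 1 by ring, Finset.sum_range_succ, Finset.sum_range_succ,
      pow_add, pow_add, ih, pow_succ (-1 : R) n, pow_succ (-1 : R) (2 * n), pow_mul]
    simp

/-! ### Exponentials of elements of square zero -/

theorem NormedSpace.exp_of_mul_self_eq_zero {A : Type*} [NormedRing A] [NormedAlgebra ℂ A] {x : A}
    (h : x * x = 0) : NormedSpace.exp x = 1 + x := by
  have h2 : ∀ k, 2 ≤ k → x ^ k = 0 := fun k hk => by
    obtain ⟨j, rfl⟩ := Nat.exists_eq_add_of_le hk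
    rw [pow_add, pow_two, h, zero_mul]
  rw [congrFun (NormedSpace.exp_eq_tsum ℂ) x, tsum_eq_sum (s := Finset.range 2)]
  · simp [Finset.sum_range_succ]
  · intro k hk
    rw [h2 k (by simp at hk; omega), smul_zero]

theorem NormedSpace.exp_sum_list_of_mul_self_eq_zero {A : Type*} [NormedRing A] [NormedAlgebra ℂ A]
    [CompleteSpace A] (l : List A) (h : ∀ x ∈ l, x * x = 0)
    (hc : ∀ x ∈ l, ∀ y ∈ l, Commute x y) :
    NormedSpace.exp l.sum = (l.map fun x => 1 + x).prod := by
  let _ : NormedAlgebra ℚ A := NormedAlgebra.restrictScalars ℚ ℂ A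
  induction l with
  | nil => simp
  | cons a l ih =>
    rw [List.sum_cons, NormedSpace.exp_add_of_commute, NormedSpace.exp_of_mul_self_eq_zero
      (h a (by simp)), ih, List.map_cons, List.prod_cons]
    · exact fun x hx => h x (List.mem_cons_of_mem _ hx)
    · exact fun x hx y hy => hc x (List.mem_cons_of_mem _ hx) y (List.mem_cons_of_mem _ hy)
    · exact Commute.list_sum_right _ _ fun b hb => hc a (by simp) b (List.mem_cons_of_mem _ hb)

noncomputable section

namespace GARTriple

variable {H : Type*} [NormedAddCommGroup H] [InnerProductSpace ℂ H] [CompleteSpace H]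
  (T : GARTriple H)

/-! ### Algebras generated by field operators -/

/-- The algebra of polynomials in the fields `G f`, `f ∈ S`. -/
def polyAlg (S : Set H) : Subalgebra ℂ T.Env := Algebra.adjoin ℂ (T.G '' S)

theorem Gr_eq : T.Gr = (T.polyAlg T.QperpH).topologicalClosure := rfl

theorem GAR_eq : T.GAR = (T.polyAlg Set.univ).topologicalClosure := by
  rw [GAR, polyAlg, Set.image_univ]

variable {T}

theorem G_mem_polyAlg {S : Set H} {f : H} (hf : f ∈ S) : T.G f ∈ T.polyAlg S :=
  Algebra.subset_adjoin ⟨f, hf, rfl⟩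

@[elab_as_elim]
theorem polyAlg_induction {S : Set H} {C : T.Env → Prop}
    (algebraMap : ∀ r, C (algebraMap ℂ T.Env r)) (G : ∀ f ∈ S, C (T.G f))
    (add : ∀ a b, C a → C b → C (a + b)) (mul : ∀ a b, C a → C b → C (a * b))
    {x : T.Env} (hx : x ∈ T.polyAlg S) : C x := by
  induction hx using Algebra.adjoin_induction with
  | mem z hz => obtain ⟨g, hg, rfl⟩ := hz; exact G g hg
  | algebraMap r => exact algebraMap r
  | add a b _ _ ha hb => exact add a b ha hb
  | mul a b _ _ ha hb => exact mul a b ha hb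

@[elab_as_elim]
theorem closure_polyAlg_induction {S : Set H} {C : T.Env → Prop} (closed : IsClosed {x | C x})
    (algebraMap : ∀ r, C (algebraMap ℂ T.Env r)) (G : ∀ f ∈ S, C (T.G f))
    (add : ∀ a b, C a → C b → C (a + b)) (mul : ∀ a b, C a → C b → C (a * b))
    {x : T.Env} (hx : x ∈ (T.polyAlg S).topologicalClosure) : C x :=
  closure_minimal (fun _ hy => polyAlg_induction algebraMap G add mul hy) closed hx

theorem Gr_le_GAR : T.Gr ≤ T.GAR := by
  rw [GAR_eq, Gr_eq]
  exact Subalgebra.topologicalClosure_mono (Algebra.adjoin_mono (Set.image_mono (Set.subset_univ _)))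

theorem G_mem_GAR (f : H) : T.G f ∈ T.GAR := by
  rw [GAR_eq]
  exact Subalgebra.le_topologicalClosure _ (G_mem_polyAlg (Set.mem_univ f))

theorem continuous_parity : Continuous T.parity := CAR.continuous_map _ _

theorem parity_mem_polyAlg {S : Set H} {x : T.Env} (hx : x ∈ T.polyAlg S) :
    T.parity x ∈ T.polyAlg S := by
  refine polyAlg_induction ?_ ?_ ?_ ?_ hx
  · intro r; rw [AlgHom.commutes]; exact Subalgebra.algebraMap_mem _ _
  · intro f hf; rw [parity_G]; exact neg_mem (G_mem_polyAlg hf)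
  · intro a b ha hb; rw [map_add]; exact add_mem ha hb
  · intro a b ha hb; rw [map_mul]; exact mul_mem ha hb

theorem parity_mem_GAR {x : T.Env} (hx : x ∈ T.GAR) : T.parity x ∈ T.GAR := by
  rw [GAR_eq] at hx ⊢
  exact map_mem_closure continuous_parity hx fun _ hy => parity_mem_polyAlg hy

theorem gstar_gstar {x : T.Env} (hx : x ∈ T.Gr) : T.gstar (T.gstar x) = x := by
  have := T.continuous_gstar
  rw [Gr_eq] at hx
  refine closure_polyAlg_induction ?_ ?_ ?_ ?_ ?_ hx
  · exact isClosed_eq (this.comp this) continuous_id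
  · intro r
    simp only [gstar_apply, ← algebraMap_star_comm, AlgHom.commutes, star_star]
  · intro f _; simp [T.J.involutive]
  · intro a b ha hb; rw [map_add, map_add, ha, hb]
  · intro a b ha hb; rw [gstar_mul, gstar_mul, ha, hb]

/-! ### Graded commutation relations -/

variable (T) in
/-- The odd elements of the Grassmann part. -/
def IsOddGr (a : T.Env) : Prop := a ∈ T.Gr ∧ T.parity a = -a

theorem isOddGr_G {g : H} (hg : g ∈ T.QperpH) : T.IsOddGr (T.G g) :=
  ⟨T.G_mem_Gr hg, T.parity_G g⟩

/-- The anticommutator of `G f` and `G g` is `⟪J f, Q g⟫`, which vanishes for `g` in the kernel of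
`Q`; the rule then passes to products and limits. -/
theorem G_mul_of_mem_Gr (f : H) {a : T.Env} (ha : a ∈ T.Gr) : T.G f * a = T.parity a * T.G f := by
  have := continuous_parity (T := T)
  rw [Gr_eq] at ha
  refine closure_polyAlg_induction ?_ ?_ ?_ ?_ ?_ ha
  · exact isClosed_eq (by fun_prop) (by fun_prop)
  · intro r; rw [AlgHom.commutes, Algebra.commutes]
  · intro g hg
    have h := T.G_anticomm f g
    rw [show T.Q g = 0 from hg, inner_zero_right, map_zero] at h
    rw [parity_G, neg_mul]
    exact eq_neg_of_add_eq_zero_left h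
  · intro a b ha hb; rw [mul_add, ha, hb, map_add, add_mul]
  · intro a b ha hb; rw [← mul_assoc, ha, mul_assoc, hb, map_mul, mul_assoc]

/-- Odd elements of the Grassmann part commute with the GAR algebra in the graded sense. -/
theorem IsOddGr.mul_eq {a X : T.Env} (ha : T.IsOddGr a) (hX : X ∈ T.GAR) :
    a * X = T.parity X * a := by
  have := continuous_parity (T := T)
  rw [GAR_eq] at hX
  refine closure_polyAlg_induction ?_ ?_ ?_ ?_ ?_ hX
  · exact isClosed_eq (by fun_prop) (by fun_prop)
  · intro r; rw [AlgHom.commutes, Algebra.commutes]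
  · intro f _; rw [parity_G, neg_mul, G_mul_of_mem_Gr f ha.1, ha.2, neg_mul, neg_neg]
  · intro X Y hX hY; rw [mul_add, hX, hY, map_add, add_mul]
  · intro X Y hX hY; rw [← mul_assoc, hX, mul_assoc, hY, map_mul, mul_assoc]

theorem IsOddGr.mem_GAR {a : T.Env} (ha : T.IsOddGr a) : a ∈ T.GAR := Gr_le_GAR ha.1

theorem IsOddGr.anticomm {a b : T.Env} (ha : T.IsOddGr a) (hb : T.IsOddGr b) :
    a * b = -(b * a) := by
  rw [ha.mul_eq hb.mem_GAR, hb.2, neg_mul]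

theorem IsOddGr.mul_self {a : T.Env} (ha : T.IsOddGr a) : a * a = 0 := by
  have h := ha.anticomm ha
  have h2 : (2 : ℂ) • (a * a) = 0 := by rw [two_smul]; nth_rw 1 [h]; simp
  simpa using h2

theorem IsOddGr.mul_G {a : T.Env} (ha : T.IsOddGr a) (f : H) : a * T.G f = -(T.G f * a) := by
  rw [ha.mul_eq (G_mem_GAR f), parity_G, neg_mul]

theorem parity_parity {X : T.Env} (hX : X ∈ T.GAR) : T.parity (T.parity X) = X := by
  have := continuous_parity (T := T)
  rw [GAR_eq] at hX
  refine closure_polyAlg_induction ?_ ?_ ?_ ?_ ?_ hX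
  · exact isClosed_eq (by fun_prop) (by fun_prop)
  · intro r; rw [AlgHom.commutes, AlgHom.commutes]
  · intro f _; rw [parity_G, map_neg, parity_G, neg_neg]
  · intro X Y hX hY; rw [map_add, map_add, hX, hY]
  · intro X Y hX hY; rw [map_mul, map_mul, hX, hY]

/-- Products of two odd elements of the Grassmann part are central in the GAR algebra. -/
theorem IsOddGr.commute_mul {a b X : T.Env} (ha : T.IsOddGr a) (hb : T.IsOddGr b)
    (hX : X ∈ T.GAR) : Commute (a * b) X := by
  rw [commute_iff_eq, mul_assoc, hb.mul_eq hX, ← mul_assoc, ha.mul_eq (parity_mem_GAR hX),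
    parity_parity hX, mul_assoc]

end GARTriple

end

noncomputable section

namespace GARTriple

variable {H : Type*} [NormedAddCommGroup H] [InnerProductSpace ℂ H] [CompleteSpace H]
  {T : GARTriple H}

/-! ### The Grassmann part separates the GAR algebra -/

/-- Here `star` is the C*-adjoint of the enveloping CAR algebra, not `gstar`. A Grassmann generator
and its C*-adjoint form an ordinary fermionic pair, which gives access to norm estimates. -/
theorem G_mul_star_G_add (f g : H) :
    T.G f * star (T.G g) + star (T.G g) * T.G f = algebraMap ℂ T.Env ⟪g, f⟫_ℂ := by
  change CAR.B T.conjHQ _ * star (CAR.B T.conjHQ _) + star (CAR.B T.conjHQ _) * CAR.B T.conjHQ _ = _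
  rw [CAR.star_B, CAR.B_anticomm, T.conjHQ.inner_map, inner_HQ]
  simp

/-- With `a = G g`, the relations `a² = 0` and `a a* + a* a = 1` make `a* a` a projection. -/
theorem norm_G_le_one {g : H} (hg : g ∈ T.QperpH) (h1 : ⟪g, g⟫_ℂ = 1) : ‖T.G g‖ ≤ 1 := by
  set a := T.G g
  have hsq : a * a = 0 := (isOddGr_G hg).mul_self
  have h := G_mul_star_G_add (T := T) g g
  rw [h1, map_one] at h
  have hid : star a * a * (star a * a) = star a * a := by
    have : star a * a * (star a * a) =
        star a * (a * star a + star a * a) * a - star a * star a * (a * a) := by noncomm_ring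
    rw [this, h, hsq]; simp
  have hn : ‖star a * a‖ * ‖star a * a‖ = ‖star a * a‖ := by
    rw [← CStarRing.norm_star_mul_self, star_mul, star_star, hid]
  rw [CStarRing.norm_star_mul_self] at hn
  have h0 := norm_nonneg a
  by_contra hlt
  push Not at hlt
  have h2 : 1 < ‖a‖ * ‖a‖ := by nlinarith
  nlinarith

/-- A polynomial involves finitely many fields `G f`, and `star (G g)` anticommutes with each of
them once `g` is orthogonal to every such `f`. -/
theorem exists_finset_mul_star_G {x : T.Env} (hx : x ∈ T.polyAlg Set.univ) :
    ∃ s : Finset H, ∀ g ∈ T.QperpH, (∀ f ∈ s, ⟪f, g⟫_ℂ = 0) →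
      x * star (T.G g) = star (T.G g) * T.parity x := by
  classical
  refine polyAlg_induction ?_ ?_ ?_ ?_ hx
  · intro r
    refine ⟨∅, fun g _ _ => ?_⟩
    rw [AlgHom.commutes, Algebra.commutes]
  · intro f _
    refine ⟨{f}, fun g hg h => ?_⟩
    have h1 := G_mul_star_G_add (T := T) f g
    rw [inner_eq_zero_symm.1 (h f (by simp)), map_zero] at h1
    rw [parity_G, mul_neg, eq_neg_of_add_eq_zero_left h1]
  · rintro a b ⟨s, hs⟩ ⟨t, ht⟩
    refine ⟨s ∪ t, fun g hg h => ?_⟩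
    rw [add_mul, hs g hg fun f hf => h f (by simp [hf]), ht g hg fun f hf => h f (by simp [hf]),
      map_add, mul_add]
  · rintro a b ⟨s, hs⟩ ⟨t, ht⟩
    refine ⟨s ∪ t, fun g hg h => ?_⟩
    rw [mul_assoc, ht g hg fun f hf => h f (by simp [hf]), ← mul_assoc,
      hs g hg fun f hf => h f (by simp [hf]), map_mul, mul_assoc]

/-- Finitely many linear functionals on an infinite-dimensional space have a common nonzero zero. -/
theorem exists_unit_orthogonal (hperp : ¬ FiniteDimensional ℂ T.QperpH) (s : Finset H) :
    ∃ g ∈ T.QperpH, ⟪g, g⟫_ℂ = 1 ∧ ∀ f ∈ s, ⟪f, g⟫_ℂ = 0 := by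
  let L : T.QperpH →ₗ[ℂ] (s → ℂ) :=
    LinearMap.pi fun f => (innerSL ℂ (f : H)).toLinearMap ∘ₗ T.QperpH.subtype
  have hL : ¬ Function.Injective L := fun h => hperp (FiniteDimensional.of_injective L h)
  rw [← LinearMap.ker_eq_bot, Submodule.eq_bot_iff] at hL
  push Not at hL
  obtain ⟨g, hg, hg0⟩ := hL
  have hn : (‖(g : H)‖ : ℂ) ≠ 0 := by simpa using hg0
  refine ⟨(‖(g : H)‖ : ℂ)⁻¹ • (g : H), Submodule.smul_mem _ _ g.2, ?_, fun f hf => ?_⟩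
  · rw [inner_smul_left, inner_smul_right, inner_self_eq_norm_sq_to_K]
    simp only [map_inv₀, Complex.conj_ofReal]
    change _ * (_ * ((‖(g : H)‖ : ℂ)) ^ 2) = 1
    field_simp
  · have := congrFun (LinearMap.mem_ker.1 hg) ⟨f, hf⟩
    rw [inner_smul_right, show ⟪f, (g : H)⟫_ℂ = 0 from this, mul_zero]

/-- Approximate `X` by a polynomial `Y` and choose a unit vector `g` in `Q^⊥ H` orthogonal to the
vectors in `Y`. The generator `G g` is then a new fermionic mode, nearly independent of `X`, so it
cannot annihilate `X` unless `X` is small. -/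
theorem eq_zero_of_mul_G_eq_zero (hperp : ¬ FiniteDimensional ℂ T.QperpH) {X : T.Env}
    (hX : X ∈ T.GAR) (h : ∀ g ∈ T.QperpH, X * T.G g = 0) : X = 0 := by
  have key : ∀ ε > 0, ‖X‖ ≤ ε + ε := fun ε hε => by
    have hU : {Y : T.Env | ‖X - Y‖ < ε ∧ ‖T.parity (Y - X)‖ < ε} ∈ nhds X := by
      have hc := continuous_parity (T := T)
      have c1 : Continuous fun Y : T.Env => ‖X - Y‖ := by fun_prop
      have c2 : Continuous fun Y : T.Env => ‖T.parity (Y - X)‖ := by fun_prop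
      exact ((isOpen_lt c1 continuous_const).inter (isOpen_lt c2 continuous_const)).mem_nhds
        (by simpa using hε)
    rw [GAR_eq] at hX
    obtain ⟨Y, ⟨h1, h2⟩, hY⟩ := mem_closure_iff_nhds.1 hX _ hU
    obtain ⟨s, hs⟩ := exists_finset_mul_star_G hY
    obtain ⟨g, hg, hg1, hgs⟩ := exists_unit_orthogonal hperp s
    have ha := norm_G_le_one hg hg1
    have hXa := h g hg
    have hYa := hs g hg hgs
    have hone := G_mul_star_G_add (T := T) g g
    have hpX : T.parity X * T.G g = 0 := by
      have := congrArg T.parity hXa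
      simpa using this
    rw [hg1, map_one] at hone
    set a := T.G g
    -- Insert `1 = a a* + a* a`. The term `X a a*` vanishes, and `Y a* a = a* p(Y) a`, where `p(X) a
    -- = 0` allows `Y` to be replaced by `Y - X`.
    have e : X = (X - Y) * (star a * a) + star a * (T.parity (Y - X) * a) := by
      calc X = X * (a * star a + star a * a) := by rw [hone, mul_one]
        _ = X * a * star a + (X - Y) * (star a * a) + Y * star a * a := by noncomm_ring
        _ = _ := by rw [hXa, hYa, map_sub, sub_mul _ _ (T.G g), hpX]; noncomm_ring
    have hsa : ‖star a‖ ≤ 1 := by rwa [norm_star]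
    have b1 : ‖(X - Y) * (star a * a)‖ ≤ ε * (1 * 1) :=
      (norm_mul_le _ _).trans (mul_le_mul h1.le ((norm_mul_le _ _).trans
        (mul_le_mul hsa ha (norm_nonneg _) zero_le_one)) (norm_nonneg _) hε.le)
    have b2 : ‖star a * (T.parity (Y - X) * a)‖ ≤ 1 * (ε * 1) :=
      (norm_mul_le _ _).trans (mul_le_mul hsa ((norm_mul_le _ _).trans
        (mul_le_mul h2.le ha (norm_nonneg _) hε.le)) (norm_nonneg _) zero_le_one)
    calc ‖X‖ = ‖(X - Y) * (star a * a) + star a * (T.parity (Y - X) * a)‖ := congrArg _ e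
      _ ≤ _ := norm_add_le _ _
      _ ≤ ε + ε := by linarith
  by_contra hne
  have h0 : 0 < ‖X‖ := norm_pos_iff.2 hne
  have := key (‖X‖ / 3) (by positivity)
  linarith

theorem eq_zero_of_mul_prod_G_eq_zero (hperp : ¬ FiniteDimensional ℂ T.QperpH) (k : ℕ)
    {X : T.Env} (hX : X ∈ T.GAR)
    (h : ∀ l : List T.QperpH, l.length = k → X * (l.map fun g : T.QperpH => T.G g).prod = 0) : X = 0 := by
  induction k generalizing X with
  | zero => simpa using h [] rfl
  | succ k ih =>
    refine eq_zero_of_mul_G_eq_zero hperp hX fun g hg => ?_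
    refine ih (mul_mem hX (G_mem_GAR g)) fun l hl => ?_
    simpa [mul_assoc] using h (⟨g, hg⟩ :: l) (by simp [hl])

/-! ### Twisted commutators -/

variable (T) in
/-- The twisted commutator `X ↦ G u p(X) - X G u` with a field, `p` being the parity. -/
def twist (u : H) : Module.End ℂ T.Env :=
  LinearMap.mulLeft ℂ (T.G u) ∘ₗ T.parity.toLinearMap - LinearMap.mulRight ℂ (T.G u)

theorem twist_apply (u : H) (X : T.Env) : T.twist u X = T.G u * T.parity X - X * T.G u := rfl

theorem continuous_twist (u : H) : Continuous (T.twist u) := by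
  have := continuous_parity (T := T)
  change Continuous fun X => T.G u * T.parity X - X * T.G u
  fun_prop

theorem twist_mem_GAR (u : H) {X : T.Env} (hX : X ∈ T.GAR) : T.twist u X ∈ T.GAR :=
  sub_mem (mul_mem (G_mem_GAR u) (parity_mem_GAR hX)) (mul_mem hX (G_mem_GAR u))

/-- The twisted Leibniz rule: `twist u` is determined by its values on the fields, where it is
scalar by `twist_G`. -/
theorem twist_mul (u : H) (X Y : T.Env) :
    T.twist u (X * Y) = T.twist u X * T.parity Y + X * T.twist u Y := by
  simp only [twist_apply, map_mul]; noncomm_ring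

theorem twist_G (u f : H) : T.twist u (T.G f) = -algebraMap ℂ T.Env ⟪T.J u, T.Q f⟫_ℂ := by
  rw [twist_apply, ← T.G_anticomm, parity_G]; noncomm_ring

theorem twist_mul_isOddGr (u : H) (X : T.Env) {a : T.Env} (ha : T.IsOddGr a) :
    T.twist u (X * a) = -(T.twist u X * a) := by
  rw [twist_mul, ha.2, twist_apply u a, ha.2, ha.mul_G]; noncomm_ring

theorem twist_eq_zero {S : Set H} {u : H} (hu : ∀ f ∈ S, ⟪T.J u, T.Q f⟫_ℂ = 0) {X : T.Env}
    (hX : X ∈ T.polyAlg S) : T.twist u X = 0 := by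
  refine polyAlg_induction ?_ ?_ ?_ ?_ hX
  · intro r; rw [twist_apply, AlgHom.commutes, Algebra.commutes, sub_self]
  · intro f hf; rw [twist_G, hu f hf, map_zero, neg_zero]
  · intro a b ha hb; rw [map_add, ha, hb, add_zero]
  · intro a b ha hb; rw [twist_mul, ha, hb, zero_mul, mul_zero, add_zero]

/-- A normal form: `G u` moves to the right past polynomials in the other fields at the cost of a
parity, and its square is a scalar, so degree at most one in `G u` suffices. -/
theorem exists_eq_add_mul_G {S : Set H} {u : H} (hu : ∀ f ∈ S, ⟪T.J u, T.Q f⟫_ℂ = 0) {X : T.Env}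
    (hX : X ∈ T.polyAlg (insert u S)) :
    ∃ a ∈ T.polyAlg S, ∃ b ∈ T.polyAlg S, X = a + b * T.G u := by
  have hmul : ∀ a ∈ T.polyAlg S, T.G u * a = T.parity a * T.G u := fun a ha => by
    have h := twist_eq_zero hu (parity_mem_polyAlg ha)
    have hpp : T.parity (T.parity a) = a := by
      refine parity_parity ?_
      rw [GAR_eq]
      exact Subalgebra.le_topologicalClosure _
        (Algebra.adjoin_mono (Set.image_mono (Set.subset_univ _)) ha)
    rw [twist_apply, hpp] at h
    exact sub_eq_zero.1 h
  have hsq : ∃ c : ℂ, T.G u * T.G u = algebraMap ℂ T.Env c := by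
    refine ⟨(1 / 2) * ⟪T.J u, T.Q u⟫_ℂ, ?_⟩
    rw [map_mul, ← T.G_anticomm, ← two_smul ℂ, ← Algebra.smul_def, smul_smul]; norm_num
  obtain ⟨c, hc⟩ := hsq
  refine polyAlg_induction ?_ ?_ ?_ ?_ hX
  · intro r
    exact ⟨_, Subalgebra.algebraMap_mem _ r, 0, zero_mem _, by simp⟩
  · rintro f (rfl | hf)
    · exact ⟨0, zero_mem _, 1, one_mem _, by simp⟩
    · exact ⟨_, G_mem_polyAlg hf, 0, zero_mem _, by simp⟩
  · rintro _ _ ⟨a, ha, b, hb, rfl⟩ ⟨a', ha', b', hb', rfl⟩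
    exact ⟨a + a', add_mem ha ha', b + b', add_mem hb hb', by noncomm_ring⟩
  · rintro _ _ ⟨a, ha, b, hb, rfl⟩ ⟨a', ha', b', hb', rfl⟩
    refine ⟨a * a' + b * T.parity b' * algebraMap ℂ T.Env c, ?_, a * b' + b * T.parity a', ?_, ?_⟩
    · exact add_mem (mul_mem ha ha') (mul_mem (mul_mem hb (parity_mem_polyAlg hb'))
        (Subalgebra.algebraMap_mem _ _))
    · exact add_mem (mul_mem ha hb') (mul_mem hb (parity_mem_polyAlg ha'))
    · rw [← hc]
      calc (a + b * T.G u) * (a' + b' * T.G u)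
          = a * a' + a * b' * T.G u + b * (T.G u * a') + b * (T.G u * b') * T.G u := by
            noncomm_ring
        _ = _ := by rw [hmul a' ha', hmul b' hb']; noncomm_ring

theorem twist_mem_polyAlg {S : Set H} {u : H} (hu : ∀ f ∈ S, ⟪T.J u, T.Q f⟫_ℂ = 0) {X : T.Env}
    (hX : X ∈ T.polyAlg (insert u S)) : T.twist u X ∈ T.polyAlg S := by
  obtain ⟨a, ha, b, hb, rfl⟩ := exists_eq_add_mul_G hu hX
  rw [map_add, twist_mul, twist_eq_zero hu ha, twist_eq_zero hu hb, twist_G]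
  simpa using mul_mem hb (Subalgebra.algebraMap_mem _ _)

variable (T) in
/-- The iterated twisted commutator `d_{u₁} ⋯ d_{uₖ}`. -/
def twists (l : List H) : Module.End ℂ T.Env := (l.map T.twist).prod

@[simp] theorem twists_nil (X : T.Env) : T.twists [] X = X := rfl

@[simp] theorem twists_cons (u : H) (l : List H) (X : T.Env) :
    T.twists (u :: l) X = T.twist u (T.twists l X) := rfl

theorem continuous_twists (l : List H) : Continuous (T.twists l) := by
  induction l with
  | nil => exact continuous_id
  | cons u l ih => exact (continuous_twist u).comp ih

theorem twists_mul_isOddGr (l : List H) (X : T.Env) {a : T.Env} (ha : T.IsOddGr a) :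
    T.twists l (X * a) = (-1 : ℂ) ^ l.length • (T.twists l X * a) := by
  induction l with
  | nil => simp
  | cons u l ih =>
    rw [twists_cons, ih, map_smul, twist_mul_isOddGr _ _ ha, smul_neg, ← neg_smul,
      List.length_cons, pow_succ, mul_neg_one, twists_cons]

/-- Each twisted commutator removes its own generator. The tail of the list acts first, so in the
induction the head `u` is counted among the remaining fields until its turn comes. -/
theorem twists_mem_polyAlg {S : Set H} {l : List H}
    (hl : l.Pairwise fun u f => ⟪T.J u, T.Q f⟫_ℂ = 0)
    (hS : ∀ u ∈ l, ∀ f ∈ S, ⟪T.J u, T.Q f⟫_ℂ = 0) {X : T.Env}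
    (hX : X ∈ T.polyAlg ({f | f ∈ l} ∪ S)) : T.twists l X ∈ T.polyAlg S := by
  have hsymm : ∀ u f : H, ⟪T.J u, T.Q f⟫_ℂ = 0 → ⟪T.J f, T.Q u⟫_ℂ = 0 := fun u f h => by
    rw [← T.inner_Q_left, ← T.comm, T.J.bilin_comm] at h
    exact h
  induction l generalizing S with
  | nil => simpa using hX
  | cons u l ih =>
    rw [List.pairwise_cons] at hl
    refine twist_mem_polyAlg (hS u (by simp)) (ih hl.2 ?_ ?_)
    · rintro w hw f (rfl | hf)
      · exact hsymm _ _ (hl.1 w hw)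
      · exact hS w (List.mem_cons_of_mem _ hw) f hf
    · convert hX using 2
      ext f
      simp [or_assoc]

theorem polyAlg_univ_le {S : Set H} (hS : (⊤ : Submodule ℂ H) ≤ Submodule.span ℂ S) :
    T.polyAlg Set.univ ≤ T.polyAlg S := by
  refine Algebra.adjoin_le ?_
  rintro _ ⟨f, -, rfl⟩
  have hf := hS (Submodule.mem_top (x := f))
  induction hf using Submodule.span_induction with
  | mem f hf => exact G_mem_polyAlg hf
  | zero => simp
  | add f g _ _ hf hg => rw [map_add]; exact add_mem hf hg
  | smul c f _ hf => rw [map_smul]; exact Subalgebra.smul_mem _ hf c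

/-- The iterated twisted commutator with an orthonormal family spanning `QH` maps the GAR algebra
to its Grassmann part. -/
theorem twists_mem_Gr {l : List H} (hl : l.Pairwise fun u f => ⟪T.J u, T.Q f⟫_ℂ = 0)
    (hspan : T.QH ≤ Submodule.span ℂ {f | f ∈ l}) {X : T.Env} (hX : X ∈ T.GAR) :
    T.twists l X ∈ T.Gr := by
  rw [GAR_eq] at hX
  rw [Gr_eq]
  refine map_mem_closure (continuous_twists l) hX fun Y hY => ?_
  refine twists_mem_polyAlg hl (fun u _ f hf => ?_) (polyAlg_univ_le ?_ hY)
  · rw [show T.Q f = 0 from hf, inner_zero_right]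
  · intro f _
    have h1 : T.Q f ∈ Submodule.span ℂ ({f | f ∈ l} ∪ (T.QperpH : Set H)) :=
      Submodule.span_mono Set.subset_union_left (hspan ⟨f, rfl⟩)
    have h2 : (T.Qperp f : H) ∈ Submodule.span ℂ ({f | f ∈ l} ∪ (T.QperpH : Set H)) :=
      Submodule.subset_span (Or.inr (T.Qperp f).2)
    simpa using add_mem h1 h2

end GARTriple

end

/-! ### Exterior algebras -/

namespace ExteriorAlgebra

variable {R M : Type*} [CommRing R] [AddCommGroup M] [Module R M]

theorem contractLeft_prod_eq_zero (d : Module.Dual R M) (l : List M) (h : ∀ a ∈ l, d a = 0) :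
    CliffordAlgebra.contractLeft (Q := 0) d (l.map (ι R)).prod = 0 := by
  induction l with
  | nil => exact CliffordAlgebra.contractLeft_one (Q := 0) d
  | cons a l ih =>
    rw [List.map_cons, List.prod_cons]
    refine (CliffordAlgebra.contractLeft_ι_mul (Q := 0) d a _).trans ?_
    rw [h a (by simp), ih fun b hb => h b (List.mem_cons_of_mem _ hb), zero_smul, mul_zero,
      sub_zero]

/-- The contraction passes each factor killed by `d` with only a sign, so the right-hand product
survives intact. -/
theorem exists_contractRight_mul_prod (d : Module.Dual R M) (l : List M) (h : ∀ a ∈ l, d a = 0)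
    (y : ExteriorAlgebra R M) :
    ∃ z, CliffordAlgebra.contractRight (Q := 0) (y * (l.reverse.map (ι R)).prod) d =
      z * (l.reverse.map (ι R)).prod := by
  induction l with
  | nil => exact ⟨CliffordAlgebra.contractRight (Q := 0) y d, by simp⟩
  | cons a l ih =>
    obtain ⟨z, hz⟩ := ih fun b hb => h b (List.mem_cons_of_mem _ hb)
    refine ⟨-z, ?_⟩
    rw [List.reverse_cons, List.map_append, List.prod_append, List.map_singleton,
      List.prod_singleton, ← mul_assoc]
    refine (CliffordAlgebra.contractRight_mul_ι (Q := 0) d a _).trans ?_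
    rw [h a (by simp), zero_smul, zero_sub, hz]
    simp only [neg_mul, mul_assoc]

theorem ι_mul_prod_eq_zero {a : M} {l : List M} (h : a ∈ l) :
    ι R a * (l.map (ι R)).prod = 0 := by
  induction l with
  | nil => simp at h
  | cons b l ih =>
    rw [List.map_cons, List.prod_cons, ← mul_assoc]
    rcases List.mem_cons.1 h with rfl | h
    · rw [ι_sq_zero, zero_mul]
    · rw [eq_neg_of_add_eq_zero_left (ι_add_mul_swap a b), neg_mul, mul_assoc, ih h, mul_zero,
        neg_zero]

/-- Everything of positive degree annihilates `E`, so only the scalar part of `x` acts. -/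
theorem mul_eq_algebraMapInv_smul {E : ExteriorAlgebra R M} (h : ∀ a, ι R a * E = 0)
    (x : ExteriorAlgebra R M) : x * E = algebraMapInv x • E := by
  induction x using ExteriorAlgebra.induction with
  | algebraMap r => rw [← Algebra.smul_def, algebraMap_leftInverse M r]
  | ι a => rw [h a]; simp [algebraMapInv]
  | mul a b ha hb =>
    rw [mul_assoc, hb, mul_smul_comm, ha, smul_smul, map_mul, mul_comm]
  | add a b ha hb => rw [add_mul, ha, hb, map_add, add_smul]

end ExteriorAlgebra

/-! ### Real orthonormal bases for a conjugation -/

/-- The fixed points of `C` form a real subspace on which the inner product is real-valued; a real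
orthonormal basis of it is a complex orthonormal basis of `K`. -/
theorem ComplexConjugation.exists_orthonormalBasis {K : Type*} [NormedAddCommGroup K]
    [InnerProductSpace ℂ K] [FiniteDimensional ℂ K] (C : ComplexConjugation K) :
    ∃ (m : ℕ) (e : OrthonormalBasis (Fin m) ℂ K), ∀ i, C (e i) = e i := by
  let _ : InnerProductSpace ℝ K := InnerProductSpace.rclikeToReal ℂ K
  let W : Submodule ℝ K :=
    { carrier := {x | C x = x}
      add_mem' := fun {x y} (hx : C x = x) (hy : C y = y) => by
        change C (x + y) = x + y; rw [map_add, hx, hy]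
      zero_mem' := map_zero C.toMap
      smul_mem' := fun c x (hx : C x = x) => by
        change C (c • x) = c • x
        rw [← Complex.coe_smul, map_smulₛₗ, hx, Complex.conj_ofReal] }
  let b := stdOrthonormalBasis ℝ W
  have hre : ∀ x y : W, ⟪(x : K), (y : K)⟫_ℂ = (⟪x, y⟫_ℝ : ℂ) := fun x y => by
    have h := C.inner_map (x : K) (y : K)
    rw [show C (x : K) = x from x.2, show C (y : K) = y from y.2, ← inner_conj_symm] at h
    have h2 : conj ⟪(x : K), (y : K)⟫_ℂ = ⟪(x : K), (y : K)⟫_ℂ := by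
      rw [← inner_conj_symm (x : K) (y : K), h, h]
    rw [← Complex.conj_eq_iff_re.1 h2]
    rfl
  have hon : Orthonormal ℂ fun i => (b i : K) := by
    rw [orthonormal_iff_ite]
    intro i j
    rw [hre, orthonormal_iff_ite.1 b.orthonormal i j]
    split_ifs <;> simp
  have hW : ∀ x : K, C x = x → x ∈ Submodule.span ℂ (Set.range fun i => (b i : K)) :=
    fun x hx => by
      have h := congrArg Subtype.val (b.sum_repr ⟨x, hx⟩)
      rw [← show _ = x from h, Submodule.coe_sum]
      refine Submodule.sum_mem _ fun i _ => ?_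
      rw [Submodule.coe_smul, ← Complex.coe_smul]
      exact Submodule.smul_mem _ _ (Submodule.subset_span ⟨i, rfl⟩)
  refine ⟨_, OrthonormalBasis.mk hon fun x _ => ?_, fun i => ?_⟩
  -- The real and imaginary parts: `x = ½ (x + C x) + (i/2) (-i (x - C x))`, where both brackets are
  -- fixed by `C`.
  · have h1 := hW (x + C x) (by rw [map_add, C.involutive, add_comm])
    have h2 := hW (-Complex.I • (x - C x)) (by
      rw [map_smulₛₗ, map_sub, C.involutive, map_neg, Complex.conj_I, neg_neg, neg_smul,
        ← smul_neg, neg_sub])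
    have h3 := add_mem (Submodule.smul_mem _ (1 / 2 : ℂ) h1)
      (Submodule.smul_mem _ (Complex.I / 2 : ℂ) h2)
    convert h3 using 1
    rw [smul_smul, show Complex.I / 2 * -Complex.I = 1 / 2 by
      rw [mul_neg, div_mul_eq_mul_div, Complex.I_mul_I]; norm_num]
    module
  · rw [OrthonormalBasis.coe_mk]
    exact (b i).2

noncomputable section

namespace GARTriple

variable {H : Type*} [NormedAddCommGroup H] [InnerProductSpace ℂ H] [CompleteSpace H]
  {T : GARTriple H}

/-! ### Real orthonormal bases and forms of highest degree -/

variable (T) in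
theorem exists_real_orthonormalBasis [FiniteDimensional ℂ T.QH] :
    ∃ (m : ℕ) (e : OrthonormalBasis (Fin m) ℂ T.QH), ∀ i, T.JQ (e i) = e i :=
  ComplexConjugation.exists_orthonormalBasis
    ⟨T.JQ, fun x => Subtype.ext (T.J.involutive x), fun x y => T.J.inner_map x y⟩

/-- Contracting `v ∧ a = 0` on the right with `⟪a, ·⟫` gives `v = (v ⌊ a) ∧ a`. Orthogonality keeps
the vectors already split off untouched by the next contraction. -/
theorem IsTopForm.exists_eq_mul_prod {v : ExteriorAlgebra ℂ T.QH} (hv : T.IsTopForm v)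
    {l : List T.QH} (hl : l.Pairwise fun a b => ⟪a, b⟫_ℂ = 0) (hl1 : ∀ a ∈ l, ⟪a, a⟫_ℂ = 1) :
    ∃ y, v = y * (l.reverse.map (ExteriorAlgebra.ι ℂ)).prod := by
  induction l with
  | nil => exact ⟨v, by simp⟩
  | cons a l ih =>
    rw [List.pairwise_cons] at hl
    obtain ⟨y, hy⟩ := ih hl.2 fun b hb => hl1 b (List.mem_cons_of_mem _ hb)
    obtain ⟨z, hz⟩ := ExteriorAlgebra.exists_contractRight_mul_prod (innerSL ℂ a).toLinearMap l
      hl.1 y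
    have h := CliffordAlgebra.contractRight_mul_ι (Q := 0) (innerSL ℂ a).toLinearMap a v
    rw [show v * CliffordAlgebra.ι 0 a = 0 from hv a, map_zero, LinearMap.zero_apply,
      show (innerSL ℂ a).toLinearMap a = 1 from hl1 a (by simp), one_smul] at h
    refine ⟨z, (sub_eq_zero.1 h.symm).trans ?_⟩
    rw [List.reverse_cons, List.map_append, List.prod_append, ← mul_assoc, ← hz, ← hy]
    simp

theorem ιMulti_eq_prod {m : ℕ} (e : Fin m → T.QH) :
    ExteriorAlgebra.ιMulti ℂ m e = (((List.finRange m).map e).map (ExteriorAlgebra.ι ℂ)).prod := by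
  rw [ExteriorAlgebra.ιMulti_apply, List.ofFn_eq_map, List.map_map]
  rfl

theorem pairwise_finRange {m : ℕ} (e : OrthonormalBasis (Fin m) ℂ T.QH) :
    ((List.finRange m).map e).Pairwise fun a b => ⟪a, b⟫_ℂ = 0 := by
  rw [List.pairwise_map]
  exact (List.nodup_finRange m).imp fun h => e.orthonormal.2 h

theorem IsTopForm.exists_eq_smul {v : ExteriorAlgebra ℂ T.QH} (hv : T.IsTopForm v) {m : ℕ}
    (e : OrthonormalBasis (Fin m) ℂ T.QH) :
    ∃ c : ℂ, v = c • ExteriorAlgebra.ιMulti ℂ m e := by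
  obtain ⟨y, hy⟩ := hv.exists_eq_mul_prod (l := ((List.finRange m).map e).reverse)
    (by
      rw [List.pairwise_reverse]
      exact (pairwise_finRange e).imp fun h => inner_eq_zero_symm.1 h)
    (by
      intro a ha
      obtain ⟨i, -, rfl⟩ := List.mem_map.1 (List.mem_reverse.1 ha)
      simp [inner_self_eq_norm_sq_to_K])
  rw [List.reverse_reverse, ← ιMulti_eq_prod] at hy
  refine ⟨_, hy.trans (ExteriorAlgebra.mul_eq_algebraMapInv_smul (fun a => ?_) y)⟩
  rw [← e.sum_repr' a, map_sum, Finset.sum_mul]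
  refine Finset.sum_eq_zero fun i _ => ?_
  rw [map_smul, smul_mul_assoc, ιMulti_eq_prod, ExteriorAlgebra.ι_mul_prod_eq_zero, smul_zero]
  exact List.mem_map_of_mem (List.mem_finRange i)

/-! ### Adjoint and norm of the volume form -/

theorem formStar_prod (l : List T.QH) (hl : ∀ a ∈ l, T.JQ a = a) :
    T.formStar (l.map (ExteriorAlgebra.ι ℂ)).prod =
      (l.map (ExteriorAlgebra.ι ℂ)).reverse.prod := by
  induction l with
  | nil => simpa [formStar] using cliffordConj_algebraMap (0 : QuadraticForm ℂ T.QH) T.JQ (by simp) 1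
  | cons a l ih =>
    rw [List.map_cons, List.reverse_cons, List.prod_append, List.prod_singleton, List.prod_cons,
      ← ih fun b hb => hl b (List.mem_cons_of_mem _ hb)]
    refine (cliffordConj_mul _ _ _ _ _).trans ?_
    congr 1
    refine (cliffordConj_ι _ _ _ _).trans ?_
    rw [hl a (by simp)]

theorem formInner_prod (l : List T.QH) (hl : l.Pairwise fun a b => ⟪a, b⟫_ℂ = 0)
    (hl1 : ∀ a ∈ l, ⟪a, a⟫_ℂ = 1) :
    T.formInner (l.map (ExteriorAlgebra.ι ℂ)).prod (l.map (ExteriorAlgebra.ι ℂ)).prod = 1 := by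
  induction l with
  | nil => simp [formInner_one]
  | cons a l ih =>
    rw [List.pairwise_cons] at hl
    rw [List.map_cons, List.prod_cons, formInner_ι_mul]
    have h := CliffordAlgebra.contractLeft_ι_mul (Q := 0) (innerSL ℂ a).toLinearMap a
      (l.map (ExteriorAlgebra.ι ℂ)).prod
    rw [show (innerSL ℂ a).toLinearMap a = 1 from hl1 a (by simp), one_smul,
      ExteriorAlgebra.contractLeft_prod_eq_zero _ l hl.1, mul_zero, sub_zero] at h
    refine Eq.trans ?_ (ih hl.2 fun b hb => hl1 b (List.mem_cons_of_mem _ hb))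
    exact congrArg _ h

theorem formInner_smul_smul (c d : ℂ) (a b : ExteriorAlgebra ℂ T.QH) :
    T.formInner (c • a) (d • b) = conj c * d * T.formInner a b := by
  simp only [formInner, map_smulₛₗ, LinearMap.smul_apply, smul_eq_mul, RingHom.id_apply]
  ring

/-- For a selfadjoint normalized form `v = c e₁ ∧ ⋯ ∧ e₂ₙ`, `c² = (-1)ⁿ`. -/
theorem sq_eq_of_selfadjoint_of_normalized {n : ℕ} {v : ExteriorAlgebra ℂ T.QH}
    (hv_adj : T.formStar v = v) (hv_norm : T.formInner v v = 1)
    (e : OrthonormalBasis (Fin (2 * n)) ℂ T.QH) (he : ∀ i, T.JQ (e i) = e i) {c : ℂ}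
    (hc : v = c • ExteriorAlgebra.ιMulti ℂ (2 * n) e) : c * c = (-1) ^ n := by
  set E := ExteriorAlgebra.ιMulti ℂ (2 * n) e with hE
  have h1 : T.formInner E E = 1 := by
    rw [hE, ιMulti_eq_prod]
    refine formInner_prod _ (pairwise_finRange e) fun a ha => ?_
    obtain ⟨i, -, rfl⟩ := List.mem_map.1 ha
    simp [inner_self_eq_norm_sq_to_K]
  have h2 : T.formStar E = (-1 : ℂ) ^ n • E := by
    rw [hE, ιMulti_eq_prod, formStar_prod, List.prod_reverse_of_anticomm, List.length_map,
      List.length_map, List.length_finRange, neg_one_pow_sum_range_two_mul, Algebra.smul_def]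
    · simp
    · intro a ha b hb
      obtain ⟨a, -, rfl⟩ := List.mem_map.1 ha
      obtain ⟨b, -, rfl⟩ := List.mem_map.1 hb
      exact ExteriorAlgebra.ι_add_mul_swap a b
    · intro a ha
      obtain ⟨i, -, rfl⟩ := List.mem_map.1 ha
      exact he i
  have h3 : conj c * c = 1 := by
    rw [hc, formInner_smul_smul, h1, mul_one] at hv_norm
    exact hv_norm
  rw [hc, map_smulₛₗ, h2, smul_smul] at hv_adj
  have h4 := congrArg (T.formInner E) hv_adj
  have hs : ∀ d : ℂ, T.formInner E (d • E) = d := fun d => by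
    simpa [h1] using formInner_smul_smul 1 d E E
  rw [hs, hs] at h4
  -- Selfadjointness gives `conj c * (-1)^n = c`, and normalization gives `conj c * c = 1`.
  calc c * c = (-1) ^ n * (conj c * c) := by nth_rw 1 [← h4]; ring
    _ = _ := by rw [h3, mul_one]

end GARTriple

end

noncomputable section

namespace GARTriple

variable {H : Type*} [NormedAddCommGroup H] [InnerProductSpace ℂ H] [CompleteSpace H]
  {T : GARTriple H}

/-! ### Components of phase space vectors -/

@[simp] theorem gstarGr_one : T.gstarGr 1 = 1 :=
  Subtype.ext (by change T.gstar 1 = 1; simp [gstar_apply])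

theorem isOddGr_coe {a : T.Gr} : T.IsOddGr a ↔ a ∈ T.GrOdd := by
  rw [mem_GrOdd]; exact ⟨fun h => h.2, fun h => ⟨a.2, h⟩⟩

theorem rigging_one_mem_GrOdd (u : T.QH) (ξ : T.PhaseEven) :
    T.rigging (u ⊗ₜ 1) (ξ : T.Phase) ∈ T.GrOdd := by
  obtain ⟨_, y, rfl⟩ := ξ
  induction y using TensorProduct.induction_on with
  | zero => simp
  | tmul f a => simpa using T.GrOdd.smul_mem _ a.2
  | add x y hx hy => simpa using add_mem hx hy

theorem isOddGr_component (u : T.QH) (ξ : T.PhaseEven) : T.IsOddGr (T.component u ξ) :=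
  isOddGr_coe.2 (rigging_one_mem_GrOdd u ξ)

@[simp] theorem component_neg (u : T.QH) (ξ : T.PhaseEven) :
    T.component u (-ξ) = -T.component u ξ := by
  simp [component]

@[simp] theorem component_smul (u : T.QH) (c : ℂ) (ξ : T.PhaseEven) :
    T.component u (c • ξ) = c • T.component u ξ := by
  simp [component]

variable (T) in
/-- The homomorphism `f₁ ∧ ⋯ ∧ fₖ ↦ ξ_{J f₁} ⋯ ξ_{J fₖ}` of the exterior algebra of `QH`. -/
def substitute (ξ : T.PhaseEven) : ExteriorAlgebra ℂ T.QH →ₐ[ℂ] T.Env :=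
  ExteriorAlgebra.lift ℂ
    ⟨{ toFun := fun u => T.component (T.JQ u) ξ
       -- `component` is antilinear in its vector; composing with `JQ` makes it linear.
       map_add' := fun u w => by simp [component, TensorProduct.add_tmul]
       map_smul' := fun c u => by
         simp only [component, map_smulₛₗ, ← TensorProduct.smul_tmul', Complex.conj_conj,
           LinearMap.smul_apply, SetLike.val_smul, RingHom.id_apply] },
      fun u => (isOddGr_component (T.JQ u) ξ).mul_self⟩

@[simp] theorem substitute_ι (ξ : T.PhaseEven) (u : T.QH) :
    T.substitute ξ (ExteriorAlgebra.ι ℂ u) = T.component (T.JQ u) ξ := by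
  rw [substitute, ExteriorAlgebra.lift_ι_apply]
  rfl

theorem rigging_tmul_left (u : T.QH) (a : T.Gr) (y : T.Phase) :
    T.rigging (u ⊗ₜ a) y = T.gstarGr a * T.rigging (u ⊗ₜ 1) y := by
  induction y using TensorProduct.induction_on with
  | zero => simp
  | tmul f b => simp
  | add x y hx hy => simp [hx, hy, mul_add]

section Basis

variable {m : ℕ} (e : OrthonormalBasis (Fin m) ℂ T.QH)

theorem sum_tmul_rigging (x : T.Phase) :
    ∑ i, e i ⊗ₜ[ℂ] T.rigging (e i ⊗ₜ 1) x = x := by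
  induction x using TensorProduct.induction_on with
  | zero => simp
  | tmul f b =>
    simp only [rigging_tmul, gstarGr_one, one_mul, ← TensorProduct.smul_tmul]
    rw [← TensorProduct.sum_tmul, e.sum_repr']
  | add x y hx hy => simp only [map_add, TensorProduct.tmul_add, Finset.sum_add_distrib, hx, hy]

theorem Phi_eq_sum (ξ : T.PhaseEven) :
    T.Phi ξ = ((List.finRange m).map fun i => T.G (e i) * T.component (e i) ξ).sum := by
  conv_lhs => rw [← sum_tmul_rigging e (ξ : T.Phase)]
  rw [map_sum, ← Fin.sum_univ_def]
  rfl

/-- The components are odd, whence the minus sign in `phaseStar`; the adjoint taken by the rigging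
map then undoes the adjoint taken by `phaseStar`. -/
theorem rigging_phaseStar (he : ∀ i, T.JQ (e i) = e i) (ξ η : T.PhaseEven) :
    (T.rigging (T.phaseStar (ξ : T.Phase)) (η : T.Phase) : T.Env) =
      ((List.finRange m).map fun i => -(T.component (e i) ξ * T.component (e i) η)).sum := by
  conv_lhs => rw [← sum_tmul_rigging e (ξ : T.Phase)]
  rw [← Fin.sum_univ_def, map_sum, map_sum, LinearMap.sum_apply, AddSubmonoidClass.coe_finsetSum]
  refine Finset.sum_congr rfl fun i _ => ?_
  rw [phaseStar_tmul_of_odd _ _ (rigging_one_mem_GrOdd _ _), he, map_neg, LinearMap.neg_apply,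
    rigging_tmul_left]
  rw [show T.gstarGr (T.gstarGr (T.rigging (e i ⊗ₜ 1) (ξ : T.Phase))) =
    T.rigging (e i ⊗ₜ 1) (ξ : T.Phase) from Subtype.ext (gstar_gstar (Subtype.property _))]
  rfl

/-- The components can be prescribed independently as Grassmann generators, so phase space has
enough points to test coefficients. -/
theorem exists_component_eq (g : Fin m → T.QperpH) :
    ∃ ξ : T.PhaseEven, ∀ i, T.component (e i) ξ = T.G (g i) := by
  let a : Fin m → T.GrOdd := fun i =>
    ⟨⟨T.G (g i), T.G_mem_Gr (g i).2⟩, isOddGr_coe.1 (isOddGr_G (g i).2)⟩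
  refine ⟨⟨_, ∑ i, e i ⊗ₜ a i, rfl⟩, fun i => ?_⟩
  simp [component, orthonormal_iff_ite.1 e.orthonormal, a]

theorem monomial_univ (e : Fin m → T.QH) (ξ : T.PhaseEven) :
    T.monomial e Finset.univ ξ = ((List.finRange m).map fun i => T.component (e i) ξ).prod := by
  rw [monomial, Fin.sort_univ]

theorem substitute_ιMulti (he : ∀ i, T.JQ (e i) = e i) (ξ : T.PhaseEven) :
    T.substitute ξ (ExteriorAlgebra.ιMulti ℂ m e) = T.monomial e Finset.univ ξ := by
  rw [monomial_univ, ιMulti_eq_prod, map_list_prod, List.map_map, List.map_map]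
  congr 1
  refine List.map_congr_left fun i _ => ?_
  simp [he]

theorem monomial_empty (e : Fin m → T.QH) (ξ : T.PhaseEven) : T.monomial e ∅ ξ = 1 := by
  simp [monomial]

theorem monomial_insert (e : Fin m → T.QH) {i : Fin m} {K : Finset (Fin m)}
    (h : ∀ j ∈ K, i < j) (ξ : T.PhaseEven) :
    T.monomial e (insert i K) ξ = T.component (e i) ξ * T.monomial e K ξ := by
  rw [monomial, Finset.sort_insert _ (fun j hj => (h j hj).le) fun hi => (h i hi).false,
    List.map_cons, List.prod_cons, monomial]

theorem list_prod_smul (c : ℂ) (l : List T.Env) :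
    (l.map fun x => c • x).prod = c ^ l.length • l.prod := by
  induction l with
  | nil => simp
  | cons a l ih => simp [ih, smul_smul, pow_succ, mul_comm]

theorem monomial_smul (e : Fin m → T.QH) (K : Finset (Fin m)) (c : ℂ) (ξ : T.PhaseEven) :
    T.monomial e K (c • ξ) = c ^ K.card • T.monomial e K ξ := by
  have h := list_prod_smul c ((K.sort (· ≤ ·)).map fun i => T.component (e i) ξ)
  rw [List.map_map, List.length_map, Finset.length_sort] at h
  rw [monomial, monomial, ← h]
  congr 2
  ext i
  simp

theorem list_prod_component_mul (l : List T.QH) (ξ : T.PhaseEven) {X : T.Env}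
    (hX : ∀ a, T.IsOddGr a → a * X = -(X * a)) :
    (l.map fun u => T.component u ξ).prod * X =
      (-1 : ℂ) ^ l.length • (X * (l.map fun u => T.component u ξ).prod) := by
  induction l with
  | nil => simp
  | cons u l ih =>
    rw [List.map_cons, List.prod_cons, mul_assoc, ih, List.length_cons, pow_succ, mul_neg_one,
      neg_smul, mul_smul_comm, ← mul_assoc, hX _ (isOddGr_component u ξ), neg_mul, smul_neg,
      mul_assoc]

/-- The hypothesis on `φ` is shared by all the twisted commutators below: right multiplication by an
odd element passes through up to a fixed factor `σ`. Such a `φ` acts on a polynomial in the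
components through its coefficients. -/
theorem map_mul_list_prod_component {φ : Module.End ℂ T.Env} {σ : ℂ}
    (hφ : ∀ X a, T.IsOddGr a → φ (X * a) = σ • (φ X * a)) (l : List T.QH) (ξ : T.PhaseEven)
    (X : T.Env) :
    φ (X * (l.map fun u => T.component u ξ).prod) =
      σ ^ l.length • (φ X * (l.map fun u => T.component u ξ).prod) := by
  induction l generalizing X with
  | nil => simp
  | cons u l ih =>
    rw [List.map_cons, List.prod_cons, ← mul_assoc, ih, hφ _ _ (isOddGr_component u ξ),
      smul_mul_assoc, smul_smul, List.length_cons, pow_succ, mul_assoc]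

theorem monomial_eq_list_prod (e : Fin m → T.QH) (K : Finset (Fin m)) (ξ : T.PhaseEven) :
    T.monomial e K ξ = (((K.sort (· ≤ ·)).map e).map fun u => T.component u ξ).prod := by
  rw [List.map_map]; rfl

theorem monomial_mul (e : Fin m → T.QH) (K : Finset (Fin m)) (ξ : T.PhaseEven) {X : T.Env}
    (hX : ∀ a, T.IsOddGr a → a * X = -(X * a)) :
    T.monomial e K ξ * X = (-1 : ℂ) ^ K.card • (X * T.monomial e K ξ) := by
  rw [monomial_eq_list_prod, list_prod_component_mul _ _ hX, List.length_map, Finset.length_sort]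

theorem map_mul_monomial {φ : Module.End ℂ T.Env} {σ : ℂ}
    (hφ : ∀ X a, T.IsOddGr a → φ (X * a) = σ • (φ X * a)) (e : Fin m → T.QH)
    (K : Finset (Fin m)) (ξ : T.PhaseEven) (X : T.Env) :
    φ (X * T.monomial e K ξ) = σ ^ K.card • (φ X * T.monomial e K ξ) := by
  rw [monomial_eq_list_prod, map_mul_list_prod_component hφ, List.length_map, Finset.length_sort]

/-! ### The Grassmann integral -/

theorem eq_zero_of_mul_monomial_eq_zero (hperp : ¬ FiniteDimensional ℂ T.QperpH) {X : T.Env}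
    (hX : X ∈ T.GAR) (h : ∀ ξ, X * T.monomial e Finset.univ ξ = 0) : X = 0 := by
  refine eq_zero_of_mul_prod_G_eq_zero hperp m hX fun l hl => ?_
  subst hl
  obtain ⟨ξ, hξ⟩ := exists_component_eq e l.get
  have h1 := h ξ
  rw [monomial_univ] at h1
  simp only [hξ] at h1
  rw [← List.ofFn_eq_map] at h1
  have h2 : l.map (fun g : T.QperpH => T.G g) = List.ofFn fun i => T.G (l.get i) := by
    conv_lhs => rw [← List.ofFn_get l]
    rw [List.map_ofFn]
    rfl
  rw [h2]
  exact h1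

/-- Every continuous functional turns the hypothesis into a scalar polynomial in `t` vanishing on
all of `ℂ`, so its coefficients vanish. -/
theorem sum_eq_zero_of_forall_sum_smul {ι V : Type*} [NormedAddCommGroup V] [NormedSpace ℂ V]
    (s : Finset ι) (d : ι → ℕ) (y : ι → V) (h : ∀ t : ℂ, ∑ i ∈ s, t ^ d i • y i = 0) (N : ℕ) :
    ∑ i ∈ s with d i = N, y i = 0 := by
  refine SeparatingDual.eq_zero_of_forall_dual_eq_zero (R := ℂ) fun f => ?_
  have hp : ∑ i ∈ s, Polynomial.monomial (d i) (f (y i)) = 0 := by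
    refine Polynomial.funext fun t => ?_
    have := congrArg f (h t)
    simpa [Polynomial.eval_finsetSum, mul_comm] using this
  have := congrArg (fun p : Polynomial ℂ => p.coeff N) hp
  rw [map_sum, Finset.sum_filter]
  simpa [Polynomial.finsetSum_coeff, Polynomial.coeff_monomial] using this

/-- Replacing `ξ` by `t • ξ` separates degrees, and the full index set is the only one of
cardinality `m`. Only the top terms as functions are compared, since `e` and `e'` may differ. -/
theorem top_coefficient_eq {e e' : Fin m → T.QH} {c c' : Finset (Fin m) → T.Env}
    (h : ∀ ξ, ∑ I, c I * T.monomial e I ξ = ∑ I, c' I * T.monomial e' I ξ) (ξ : T.PhaseEven) :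
    c Finset.univ * T.monomial e Finset.univ ξ = c' Finset.univ * T.monomial e' Finset.univ ξ := by
  have h1 := sum_eq_zero_of_forall_sum_smul Finset.univ Finset.card
    (fun I : Finset (Fin m) => c I * T.monomial e I ξ - c' I * T.monomial e' I ξ)
    (fun t => by
      have := h (t • ξ)
      simp only [monomial_smul, mul_smul_comm] at this
      simp only [smul_sub, Finset.sum_sub_distrib, this, sub_self]) m
  have h2 : ({I : Finset (Fin m) | I.card = m} : Finset (Finset (Fin m))) = {Finset.univ} := by
    ext I
    simp [← Finset.card_eq_iff_eq_univ]
  rw [h2, Finset.sum_singleton] at h1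
  exact sub_eq_zero.1 h1

theorem IsIntegralValue.unique {n : ℕ} (hrank : Module.finrank ℂ T.QH = 2 * n)
    (hperp : ¬ FiniteDimensional ℂ T.QperpH) {v : ExteriorAlgebra ℂ T.QH}
    (hv_adj : T.formStar v = v) (hv_norm : T.formInner v v = 1) {F : T.PhaseEven → T.Env}
    {X Y : T.Env} (hX : T.IsIntegralValue T.GAR v F X) (hY : T.IsIntegralValue T.GAR v F Y) :
    X = Y := by
  obtain ⟨m, e, c, r, he, hc, hF, hv, rfl⟩ := hX
  obtain ⟨m', e', c', r', he', hc', hF', hv', rfl⟩ := hY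
  obtain rfl : m = 2 * n := by rw [← hrank, Module.finrank_eq_card_basis e.toBasis, Fintype.card_fin]
  obtain rfl : m' = 2 * n := by
    rw [← hrank, Module.finrank_eq_card_basis e'.toBasis, Fintype.card_fin]
  have hr := sq_eq_of_selfadjoint_of_normalized hv_adj hv_norm e he hv
  have hr' := sq_eq_of_selfadjoint_of_normalized hv_adj hv_norm e' he' hv'
  have h1 : ((-1 : ℂ) ^ n) * (-1) ^ n = 1 := by rw [← mul_pow]; simp
  rw [← sub_eq_zero]
  refine eq_zero_of_mul_monomial_eq_zero e hperp
    (sub_mem (Subalgebra.smul_mem _ (hc _) r) (Subalgebra.smul_mem _ (hc' _) r')) fun ξ => ?_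
  have h2 := top_coefficient_eq (fun ξ => (hF ξ).symm.trans (hF' ξ)) ξ
  -- Both sides are the image of the single form `v` under substitution of `ξ`.
  have h3 : r • T.monomial e Finset.univ ξ = r' • T.monomial e' Finset.univ ξ := by
    rw [← substitute_ιMulti e he, ← substitute_ιMulti e' he', ← map_smul (T.substitute ξ),
      ← map_smul (T.substitute ξ), ← hv, ← hv']
  rw [sub_mul, smul_mul_assoc, smul_mul_assoc, h2, sub_eq_zero]
  -- As `r * r = (-1)^n`, the inverse of `r` is `(-1)^n * r`.
  have h4 : T.monomial e Finset.univ ξ = ((-1) ^ n * r * r') • T.monomial e' Finset.univ ξ := by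
    rw [mul_smul, ← h3, smul_smul, mul_assoc, hr, h1, one_smul]
  rw [h4, mul_smul_comm, smul_smul, show r' * ((-1) ^ n * r * r') = r by
    rw [show r' * ((-1) ^ n * r * r') = (-1) ^ n * (r' * r') * r by ring, hr', h1, one_mul]]

theorem monomial_sum_mem_GHol {E : Subalgebra ℂ T.Env} (e : Fin m → T.QH)
    {c : Finset (Fin m) → T.Env} (hc : ∀ I, c I ∈ E) :
    (fun ξ => ∑ I, c I * T.monomial e I ξ) ∈ T.GHol E := by
  have : (fun ξ => ∑ I, c I * T.monomial e I ξ) = ∑ I, fun ξ => c I * T.monomial e I ξ := by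
    ext ξ; simp
  rw [this]
  refine Submodule.sum_mem _ fun I _ => Submodule.subset_span ?_
  refine ⟨c I, hc I, (I.sort (· ≤ ·)).map e, ?_⟩
  ext ξ
  rw [List.map_map]
  rfl

end Basis

end GARTriple

end

noncomputable section

namespace GARTriple

variable {H : Type*} [NormedAddCommGroup H] [InnerProductSpace ℂ H] [CompleteSpace H]
  {T : GARTriple H} {m : ℕ}

/-! ### Expansion in monomials -/

/-- Expands a composition of steps, the largest index acting first. A step either keeps the monomial
(`P`) or puts its new component in front (`R`), so the top coefficient uses `R` every time; `Z`
records that product. The degree argument of `P` and `R` carries the sign from crossing the monomial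
already present. -/
theorem exists_expansion (e : Fin m → T.QH) (step : T.PhaseEven → Fin m → Module.End ℂ T.Env)
    (P R : Fin m → ℕ → Module.End ℂ T.Env)
    (hP : ∀ i k, ∀ X ∈ T.GAR, P i k X ∈ T.GAR) (hR : ∀ i k, ∀ X ∈ T.GAR, R i k X ∈ T.GAR)
    (hstep : ∀ η i K X, X ∈ T.GAR → step η i (X * T.monomial e K η) =
      P i K.card X * T.monomial e K η +
        R i K.card X * (T.component (e i) η * T.monomial e K η))
    {A : T.Env} (hA : A ∈ T.GAR) (Z : Finset (Fin m) → T.Env) (hZ0 : Z ∅ = A)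
    (hZ : ∀ i K, (∀ j ∈ K, i < j) → Z (insert i K) = R i K.card (Z K)) (s : Finset (Fin m)) :
    ∃ c : Finset (Fin m) → T.Env, (∀ K, c K ∈ T.GAR) ∧
      (∀ η, ((s.sort (· ≤ ·)).map (step η)).prod A = ∑ K ∈ s.powerset, c K * T.monomial e K η) ∧
      c s = Z s := by
  induction s using Finset.induction_on_min with
  | empty =>
    refine ⟨fun _ => A, fun _ => hA, fun η => ?_, hZ0.symm⟩
    simp [monomial_empty]
  | insert i s hi ih =>
    obtain ⟨c, hc, hF, hs⟩ := ih
    have his : i ∉ s := fun h => (hi i h).false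
    refine ⟨fun K => if i ∈ K then R i (K.erase i).card (c (K.erase i)) else P i K.card (c K),
      fun K => ?_, fun η => ?_, ?_⟩
    · dsimp only
      split_ifs
      · exact hR _ _ _ (hc _)
      · exact hP _ _ _ (hc _)
    · rw [Finset.sort_insert _ (fun j hj => (hi j hj).le) his, List.map_cons, List.prod_cons,
        Module.End.mul_apply, hF, map_sum, Finset.sum_powerset_insert his,
        ← Finset.sum_add_distrib]
      refine Finset.sum_congr rfl fun K hK => ?_
      have hKs := Finset.mem_powerset.1 hK
      have hiK : i ∉ K := fun h => his (hKs h)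
      dsimp only
      rw [hstep _ _ _ _ (hc K), if_neg hiK, if_pos (Finset.mem_insert_self _ _),
        Finset.erase_insert hiK, monomial_insert e fun j hj => hi j (hKs hj)]
    · dsimp only
      rw [if_pos (Finset.mem_insert_self _ _), Finset.erase_insert his, hs, hZ i s hi]

variable (T) in
/-- The operator `X ↦ G u p(X) - X (G u + a)`. -/
def shiftedTwist (u : H) (a : T.Env) : Module.End ℂ T.Env := T.twist u - LinearMap.mulRight ℂ a

theorem shiftedTwist_apply (u : H) (a X : T.Env) :
    T.shiftedTwist u a X = T.twist u X - X * a := rfl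

theorem shiftedTwist_mem_GAR (u : H) {a X : T.Env} (ha : T.IsOddGr a) (hX : X ∈ T.GAR) :
    T.shiftedTwist u a X ∈ T.GAR :=
  sub_mem (twist_mem_GAR u hX) (mul_mem hX ha.mem_GAR)

theorem shiftedTwist_mul (u : H) {a b : T.Env} (ha : T.IsOddGr a) (X : T.Env)
    (hb : T.IsOddGr b) : T.shiftedTwist u a (X * b) = (-1 : ℂ) • (T.shiftedTwist u a X * b) := by
  rw [shiftedTwist_apply, shiftedTwist_apply, twist_mul_isOddGr u X hb, mul_assoc,
    hb.anticomm ha, sub_mul, mul_assoc, neg_one_smul]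
  noncomm_ring

variable (T) in
/-- The conjugation of `X` with `1 + G u b`, multiplied with `1 - a b`. -/
def fourierStep (u : H) (a b : T.Env) : Module.End ℂ T.Env :=
  LinearMap.id + LinearMap.mulRight ℂ b ∘ₗ T.shiftedTwist u a

theorem fourierStep_apply (u : H) (a b X : T.Env) :
    T.fourierStep u a b X = X + T.shiftedTwist u a X * b := rfl

theorem fourierStep_mem_GAR (u : H) {a b X : T.Env} (ha : T.IsOddGr a) (hb : T.IsOddGr b)
    (hX : X ∈ T.GAR) : T.fourierStep u a b X ∈ T.GAR :=
  add_mem hX (mul_mem (shiftedTwist_mem_GAR u ha hX) hb.mem_GAR)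

/-- All terms of second order in `b` vanish, because `b² = 0` and `b` anticommutes with both `G u`
and `a`. -/
theorem fourierStep_eq (u : H) {a b X : T.Env} (ha : T.IsOddGr a) (hb : T.IsOddGr b)
    (hX : X ∈ T.GAR) :
    (1 + T.G u * b) * X * (1 - T.G u * b) * (1 - a * b) = T.fourierStep u a b X := by
  have h1 : b * X = T.parity X * b := hb.mul_eq hX
  have h2 : b * T.G u * b = 0 := by rw [hb.mul_G, neg_mul, mul_assoc, hb.mul_self]; simp
  have h3 : b * a * b = 0 := by rw [hb.anticomm ha, neg_mul, mul_assoc, hb.mul_self]; simp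
  have h4 : (1 + T.G u * b) * X * (1 - T.G u * b) = X + T.twist u X * b := by
    calc (1 + T.G u * b) * X * (1 - T.G u * b)
        = X + T.G u * (b * X) - X * T.G u * b - T.G u * (b * X) * T.G u * b := by noncomm_ring
      _ = X + T.G u * (T.parity X * b) - X * T.G u * b -
            T.G u * T.parity X * (b * T.G u * b) := by rw [h1]; noncomm_ring
      _ = _ := by rw [h2, twist_apply]; noncomm_ring
  rw [h4, fourierStep_apply, shiftedTwist_apply]
  calc (X + T.twist u X * b) * (1 - a * b)
      = X + T.twist u X * b - X * a * b - T.twist u X * (b * a * b) := by noncomm_ring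
    _ = _ := by rw [h3]; noncomm_ring

/-! ### Weyl operators -/

theorem G_mul_G_of_orthogonal (e : OrthonormalBasis (Fin m) ℂ T.QH) (he : ∀ i, T.JQ (e i) = e i)
    {i j : Fin m} (hij : i ≠ j) : T.G (e i) * T.G (e j) = -(T.G (e j) * T.G (e i)) := by
  have h := T.G_anticomm (e i) (e j)
  have h1 : T.J (e i : H) = e i := congrArg Subtype.val (he i)
  have h2 : ⟪(e i : H), (e j : H)⟫_ℂ = 0 := e.orthonormal.2 hij
  rw [h1, T.Q_of_mem (e j).2, h2, map_zero] at h
  exact eq_neg_of_add_eq_zero_left h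

theorem G_mul_G_self (e : OrthonormalBasis (Fin m) ℂ T.QH) (he : ∀ i, T.JQ (e i) = e i)
    (i : Fin m) : T.G (e i) * T.G (e i) + T.G (e i) * T.G (e i) = 1 := by
  have h := T.G_anticomm (e i) (e i)
  have h1 : T.J (e i : H) = e i := congrArg Subtype.val (he i)
  have h2 : ⟪(e i : H), (e i : H)⟫_ℂ = 1 := by
    have := orthonormal_iff_ite.1 e.orthonormal i i
    rwa [if_pos rfl] at this
  rwa [h1, T.Q_of_mem (e i).2, h2, map_one] at h

theorem G_mul_isOddGr_mul_self (u : H) {a : T.Env} (ha : T.IsOddGr a) :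
    T.G u * a * (T.G u * a) = 0 := by
  rw [mul_assoc, ← mul_assoc a, ha.mul_G, neg_mul, mul_assoc, ha.mul_self]; simp

theorem commute_G_mul_of_anticomm {u : H} {a X : T.Env} (ha : a * X = -(X * a))
    (hu : T.G u * X = -(X * T.G u)) : Commute (T.G u * a) X := by
  rw [commute_iff_eq, mul_assoc, ha, mul_neg, ← mul_assoc, hu, neg_mul, neg_neg, mul_assoc]

theorem commute_G_mul_G_mul (e : OrthonormalBasis (Fin m) ℂ T.QH) (he : ∀ i, T.JQ (e i) = e i)
    (ξ η : T.PhaseEven) {i j : Fin m} (hij : i ≠ j) :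
    Commute (T.G (e i) * T.component (e i) ξ) (T.G (e j) * T.component (e j) η) := by
  have hi := isOddGr_component (e i) ξ
  have hj := isOddGr_component (e j) η
  rw [commute_iff_eq, mul_assoc, ← mul_assoc _ (T.G (e j)), hi.mul_G, mul_assoc _ _ (T.G (e i) * _),
    ← mul_assoc _ (T.G (e i)), hj.mul_G]
  simp only [neg_mul, mul_neg, mul_assoc]
  rw [hi.anticomm hj]
  simp only [mul_neg, ← mul_assoc]
  rw [G_mul_G_of_orthogonal e he hij]
  simp only [neg_mul, neg_neg]

theorem weyl_eq_prod (e : OrthonormalBasis (Fin m) ℂ T.QH) (he : ∀ i, T.JQ (e i) = e i)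
    (ξ : T.PhaseEven) :
    T.weyl ξ = ((List.finRange m).map fun i => 1 + T.G (e i) * T.component (e i) ξ).prod := by
  rw [weyl, Phi_eq_sum e, NormedSpace.exp_sum_list_of_mul_self_eq_zero, List.map_map]
  · rfl
  · intro x hx
    obtain ⟨i, -, rfl⟩ := List.mem_map.1 hx
    exact G_mul_isOddGr_mul_self _ (isOddGr_component _ _)
  · intro x hx y hy
    obtain ⟨i, -, rfl⟩ := List.mem_map.1 hx
    obtain ⟨j, -, rfl⟩ := List.mem_map.1 hy
    rcases eq_or_ne i j with rfl | hij
    · exact Commute.refl _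
    · exact commute_G_mul_G_mul e he ξ ξ hij

theorem weyl_neg_eq_prod (e : OrthonormalBasis (Fin m) ℂ T.QH) (he : ∀ i, T.JQ (e i) = e i)
    (ξ : T.PhaseEven) :
    T.weyl (-ξ) = ((List.finRange m).map fun i => 1 - T.G (e i) * T.component (e i) ξ).prod := by
  rw [weyl_eq_prod e he]
  simp [sub_eq_add_neg]

theorem weyl_neg_mul_weyl (ξ : T.PhaseEven) : T.weyl (-ξ) * T.weyl ξ = 1 := by
  let _ : NormedAlgebra ℚ T.Env := NormedAlgebra.restrictScalars ℚ ℂ T.Env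
  rw [weyl, weyl, Submodule.coe_neg, map_neg,
    ← NormedSpace.exp_add_of_commute (Commute.refl _).neg_left, neg_add_cancel,
    NormedSpace.exp_zero]

theorem weyl_mul_weyl_neg (ξ : T.PhaseEven) : T.weyl ξ * T.weyl (-ξ) = 1 := by
  have := weyl_neg_mul_weyl (-ξ)
  rwa [show -(-ξ) = ξ from neg_neg ξ] at this

/-- An element of `Gr` passing `G_i ξ_i` undergoes the parity twice, so it commutes with the
exponent. -/
theorem commute_weyl_of_mem_Gr (e : OrthonormalBasis (Fin m) ℂ T.QH) {a : T.Env} (ha : a ∈ T.Gr)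
    (ξ : T.PhaseEven) : Commute a (T.weyl ξ) := by
  refine Commute.exp_right ?_
  rw [Phi_eq_sum e]
  refine Commute.list_sum_right _ _ fun x hx => ?_
  obtain ⟨i, -, rfl⟩ := List.mem_map.1 hx
  have hξ := isOddGr_component (e i) ξ
  rw [commute_iff_eq, mul_assoc, hξ.mul_eq (Gr_le_GAR ha), ← mul_assoc, ← mul_assoc,
    G_mul_of_mem_Gr _ (T.parity_mem_Gr ha), parity_parity (Gr_le_GAR ha)]

theorem parity_weyl (e : OrthonormalBasis (Fin m) ℂ T.QH) (he : ∀ i, T.JQ (e i) = e i)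
    (ξ : T.PhaseEven) : T.parity (T.weyl ξ) = T.weyl ξ := by
  rw [weyl_eq_prod e he, map_list_prod, List.map_map]
  congr 1
  refine List.map_congr_left fun i _ => ?_
  simp [(isOddGr_component (e i) ξ).2]

/-- Translation of a field by a phase space vector. -/
theorem G_add_component_mul_weyl_neg (e : OrthonormalBasis (Fin m) ℂ T.QH)
    (he : ∀ i, T.JQ (e i) = e i) (ξ : T.PhaseEven) (i : Fin m) :
    (T.G (e i) + T.component (e i) ξ) * T.weyl (-ξ) = T.weyl (-ξ) * T.G (e i) := by
  have hξ := isOddGr_component (e i) ξ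
  have hG : ∀ j, j ≠ i → Commute (T.G (e i)) (1 - T.G (e j) * T.component (e j) ξ) := fun j hj =>
    (Commute.one_right _).sub_right (commute_G_mul_of_anticomm
      ((isOddGr_component (e j) ξ).mul_G _) (G_mul_G_of_orthogonal e he hj)).symm
  have hC : ∀ j, Commute (T.component (e i) ξ) (1 - T.G (e j) * T.component (e j) ξ) := fun j =>
    (Commute.one_right _).sub_right (commute_G_mul_of_anticomm
      ((isOddGr_component (e j) ξ).anticomm hξ) (by rw [hξ.mul_G, neg_neg])).symm
  -- Only the factor with index `i` matters, the others commuting with both summands. Here `2 G_i² =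
  -- 1` produces the shift by `ξ_i`.
  have hi : (T.G (e i) + T.component (e i) ξ) * (1 - T.G (e i) * T.component (e i) ξ) =
      (1 - T.G (e i) * T.component (e i) ξ) * T.G (e i) := by
    have h1 := G_mul_G_self e he i
    have h2 := hξ.mul_G (e i)
    have h3 := hξ.mul_self
    have h4 : T.component (e i) ξ * T.G (e i) * T.component (e i) ξ = 0 := by
      rw [h2, neg_mul, mul_assoc, h3, mul_zero, neg_zero]
    rw [sub_mul, mul_assoc, h2]
    calc _ = T.G (e i) + T.component (e i) ξ - T.G (e i) * T.G (e i) * T.component (e i) ξ -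
          T.component (e i) ξ * T.G (e i) * T.component (e i) ξ := by noncomm_ring
      _ = T.G (e i) + (T.G (e i) * T.G (e i) + T.G (e i) * T.G (e i)) * T.component (e i) ξ -
          T.G (e i) * T.G (e i) * T.component (e i) ξ := by rw [h4, h1, one_mul, sub_zero]
      _ = _ := by noncomm_ring
  have key : ∀ l : List (Fin m), l.Nodup → i ∈ l →
      (T.G (e i) + T.component (e i) ξ) *
        (l.map fun j => 1 - T.G (e j) * T.component (e j) ξ).prod =
      (l.map fun j => 1 - T.G (e j) * T.component (e j) ξ).prod * T.G (e i) := fun l => by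
    induction l with
    | nil => simp
    | cons j l ih =>
      intro hl hmem
      rw [List.nodup_cons] at hl
      rw [List.map_cons, List.prod_cons, ← mul_assoc]
      rcases eq_or_ne j i with rfl | hj
      · rw [hi, mul_assoc, mul_assoc]
        congr 1
        refine Commute.list_prod_right _ _ fun x hx => ?_
        obtain ⟨k, hk, rfl⟩ := List.mem_map.1 hx
        exact hG k fun h => hl.1 (h ▸ hk)
      · rw [((hG j hj).add_left (hC j)).eq, mul_assoc,
          ih hl.2 ((List.mem_cons.1 hmem).resolve_left hj.symm), mul_assoc]
  rw [weyl_neg_eq_prod e he]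
  exact key _ (List.nodup_finRange m) (List.mem_finRange i)

/-- Since `w(-ξ)` is even and `X (G_i + ξ_i) w(-ξ) = X w(-ξ) G_i`, multiplication by it turns each
shifted operator into the unshifted one. -/
theorem prod_shiftedTwist_mul_weyl_neg (e : OrthonormalBasis (Fin m) ℂ T.QH)
    (he : ∀ i, T.JQ (e i) = e i) (ξ : T.PhaseEven) (l : List (Fin m)) (A : T.Env) :
    (l.map fun i => T.shiftedTwist (e i) (T.component (e i) ξ)).prod A * T.weyl (-ξ) =
      T.twists (l.map fun i => (e i : H)) (A * T.weyl (-ξ)) := by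
  induction l with
  | nil => simp
  | cons i l ih =>
    rw [List.map_cons, List.prod_cons, Module.End.mul_apply, List.map_cons, twists_cons, ← ih,
      twist_apply, shiftedTwist_apply, twist_apply, map_mul, parity_weyl e he,
      mul_assoc _ (T.weyl (-ξ)), ← G_add_component_mul_weyl_neg e he]
    noncomm_ring

theorem fourierIntegrand_eq (e : OrthonormalBasis (Fin m) ℂ T.QH) (he : ∀ i, T.JQ (e i) = e i)
    {A : T.Env} (hA : A ∈ T.GAR) (ξ η : T.PhaseEven) :
    T.fourierIntegrand A ξ η = ((List.finRange m).map fun i =>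
      T.fourierStep (e i) (T.component (e i) ξ) (T.component (e i) η)).prod A := by
  have hc := fun i => isOddGr_component (e i) ξ
  have hd := fun i => isOddGr_component (e i) η
  have hexp : NormedSpace.exp (T.rigging (T.phaseStar (ξ : T.Phase)) (η : T.Phase) : T.Env) =
      ((List.finRange m).map fun i => 1 - T.component (e i) ξ * T.component (e i) η).prod := by
    have hcc : ∀ i j, Commute (T.component (e i) ξ * T.component (e i) η)
        (T.component (e j) ξ * T.component (e j) η) := fun i j =>
      (hc i).commute_mul (hd i) (mul_mem (hc j).mem_GAR (hd j).mem_GAR)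
    rw [rigging_phaseStar e he, NormedSpace.exp_sum_list_of_mul_self_eq_zero, List.map_map]
    · simp [Function.comp_def, sub_eq_add_neg]
    · intro x hx
      obtain ⟨i, -, rfl⟩ := List.mem_map.1 hx
      rw [neg_mul_neg, mul_assoc, ← mul_assoc _ (T.component (e i) ξ), (hd i).anticomm (hc i),
        neg_mul, mul_assoc, (hd i).mul_self]
      simp
    · intro x hx y hy
      obtain ⟨i, -, rfl⟩ := List.mem_map.1 hx
      obtain ⟨j, -, rfl⟩ := List.mem_map.1 hy
      exact ((hcc i j).neg_left).neg_right
  -- The conjugation is built from the inside out, one index at a time. Membership in `GAR` is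
  -- carried along because `fourierStep_eq` needs it.
  have key : ∀ l : List (Fin m), l.Nodup →
      (l.map fun i => T.fourierStep (e i) (T.component (e i) ξ) (T.component (e i) η)).prod A
        ∈ T.GAR ∧
      (l.map fun i => 1 + T.G (e i) * T.component (e i) η).prod * A *
        (l.map fun i => 1 - T.G (e i) * T.component (e i) η).prod *
        (l.map fun i => 1 - T.component (e i) ξ * T.component (e i) η).prod =
      (l.map fun i => T.fourierStep (e i) (T.component (e i) ξ) (T.component (e i) η)).prod A :=
      fun l => by
    induction l with
    | nil => simpa using hA
    | cons i l ih =>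
      intro hl
      rw [List.nodup_cons] at hl
      obtain ⟨hmem, heq⟩ := ih hl.2
      simp only [List.map_cons, List.prod_cons, Module.End.mul_apply]
      refine ⟨fourierStep_mem_GAR _ (hc i) (hd i) hmem, ?_⟩
      rw [← fourierStep_eq _ (hc i) (hd i) hmem, ← heq]
      -- To make the `i`-th factors outermost, `q` moves to the right of `N`, and then `q r` past
      -- the product `E` of even factors.
      have c1 : Commute (1 - T.G (e i) * T.component (e i) η)
          (l.map fun i => 1 - T.G (e i) * T.component (e i) η).prod := by
        refine Commute.list_prod_right _ _ fun x hx => ?_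
        obtain ⟨j, hj, rfl⟩ := List.mem_map.1 hx
        exact (Commute.one_left _).sub_left ((Commute.one_right _).sub_right
          (commute_G_mul_G_mul e he η η fun h => hl.1 (h ▸ hj)))
      have c2 : ∀ Y ∈ T.GAR, Commute Y
          (l.map fun i => 1 - T.component (e i) ξ * T.component (e i) η).prod := fun Y hY => by
        refine Commute.list_prod_right _ _ fun x hx => ?_
        obtain ⟨j, hj, rfl⟩ := List.mem_map.1 hx
        exact (Commute.one_right _).sub_right ((hc j).commute_mul (hd j) hY).symm
      have c3 := c2 ((1 - T.G (e i) * T.component (e i) η) *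
          (1 - T.component (e i) ξ * T.component (e i) η))
        (mul_mem (sub_mem (one_mem _) (mul_mem (G_mem_GAR _) (hd i).mem_GAR))
          (sub_mem (one_mem _) (mul_mem (hc i).mem_GAR (hd i).mem_GAR)))
      have c4 := c2 (1 - T.component (e i) ξ * T.component (e i) η)
          (sub_mem (one_mem _) (mul_mem (hc i).mem_GAR (hd i).mem_GAR))
      set M := (l.map fun i => 1 + T.G (e i) * T.component (e i) η).prod
      set N := (l.map fun i => 1 - T.G (e i) * T.component (e i) η).prod
      set E := (l.map fun i => 1 - T.component (e i) ξ * T.component (e i) η).prod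
      set p := 1 + T.G (e i) * T.component (e i) η
      set q := 1 - T.G (e i) * T.component (e i) η
      set r := 1 - T.component (e i) ξ * T.component (e i) η
      calc p * M * A * (q * N) * (r * E) = p * M * A * (N * q) * (r * E) := by rw [c1.eq]
        _ = p * M * A * N * (q * r * E) := by simp only [mul_assoc]
        _ = p * M * A * N * (E * (q * r)) := by rw [c3.eq]
        _ = _ := by simp only [mul_assoc]
  rw [fourierIntegrand, translate, show -(-η) = η from neg_neg η, hexp, weyl_eq_prod e he, weyl_neg_eq_prod e he]
  exact (key _ (List.nodup_finRange m)).2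

/-! ### The Fourier transform -/

theorem exists_fourierIntegrand_expansion (e : OrthonormalBasis (Fin m) ℂ T.QH)
    (he : ∀ i, T.JQ (e i) = e i) {A : T.Env} (hA : A ∈ T.GAR) (ξ : T.PhaseEven) :
    ∃ c : Finset (Fin m) → T.Env, (∀ K, c K ∈ T.GAR) ∧
      (∀ η, T.fourierIntegrand A ξ η = ∑ K, c K * T.monomial e K η) ∧
      c Finset.univ = ((List.finRange m).map fun i =>
        T.shiftedTwist (e i) (T.component (e i) ξ)).prod A := by
  have hc := fun i => isOddGr_component (e i) ξ
  obtain ⟨c, hcm, hF, htop⟩ := exists_expansion e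
    (fun η i => T.fourierStep (e i) (T.component (e i) ξ) (T.component (e i) η))
    (fun _ _ => LinearMap.id) (fun i _ => T.shiftedTwist (e i) (T.component (e i) ξ))
    (fun _ _ _ hX => hX) (fun i _ _ hX => shiftedTwist_mem_GAR _ (hc i) hX)
    -- The sign from taking the operator past the monomial cancels the one from moving `η_i` in
    -- front of it, so `R` needs no dependence on the degree.
    (fun η i K X _ => by
      rw [fourierStep_apply, map_mul_monomial (fun X a ha => shiftedTwist_mul _ (hc i) X ha),
        smul_mul_assoc, mul_assoc, monomial_mul _ _ _
          fun a ha => ha.anticomm (isOddGr_component (e i) η), mul_smul_comm, smul_smul,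
        ← mul_pow, neg_one_mul, neg_neg, one_pow, one_smul]
      rfl)
    hA (fun s => ((s.sort (· ≤ ·)).map fun i =>
      T.shiftedTwist (e i) (T.component (e i) ξ)).prod A) (by simp)
    (fun i K hi => by
      rw [Finset.sort_insert _ (fun j hj => (hi j hj).le) fun h => (hi i h).false]
      simp)
    Finset.univ
  refine ⟨c, hcm, fun η => ?_, ?_⟩
  · rw [fourierIntegrand_eq e he hA, ← Finset.powerset_univ, ← hF, Fin.sort_univ]
  · rw [htop, Fin.sort_univ]

/-- In `D_i (X ξ_K)` with `k = |K|`, the part raising the degree is `-X ξ_K ξ_i = -(-1)^k X ξ_i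
ξ_K`; multiplying the factors `-(-1)^k` for `k < m` gives the top coefficient. -/
theorem exists_inverse_expansion (e : Fin m → T.QH) {A : T.Env} (hA : A ∈ T.GAR) :
    ∃ c : Finset (Fin m) → T.Env, (∀ K, c K ∈ T.GAR) ∧
      (∀ ξ, ((List.finRange m).map fun i =>
        T.shiftedTwist (e i) (T.component (e i) ξ)).prod A = ∑ K, c K * T.monomial e K ξ) ∧
      c Finset.univ = ((-1 : ℂ) ^ m * (-1) ^ (∑ k ∈ Finset.range m, k)) • A := by
  obtain ⟨c, hcm, hF, htop⟩ := exists_expansion e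
    (fun ξ i => T.shiftedTwist (e i) (T.component (e i) ξ))
    (fun i k => (-1 : ℂ) ^ k • T.twist (e i)) (fun i k => -(-1 : ℂ) ^ k • LinearMap.id)
    (fun i k X hX => Subalgebra.smul_mem _ (twist_mem_GAR _ hX) _)
    (fun i k X hX => Subalgebra.smul_mem _ hX _)
    (fun ξ i K X _ => by
      rw [shiftedTwist_apply, map_mul_monomial (σ := -1) (fun X a ha => by
          rw [twist_mul_isOddGr _ X ha, neg_one_smul]), mul_assoc,
        monomial_mul _ _ _ fun a ha => ha.anticomm (isOddGr_component (e i) ξ), mul_smul_comm]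
      simp [sub_eq_add_neg])
    hA (fun s => ((-1 : ℂ) ^ s.card * (-1) ^ (∑ k ∈ Finset.range s.card, k)) • A) (by simp)
    (fun i K hi => by
      rw [Finset.card_insert_of_notMem fun h => (hi i h).false, Finset.sum_range_succ]
      simp only [LinearMap.smul_apply, LinearMap.id_apply, smul_smul]
      congr 1
      ring)
    Finset.univ
  refine ⟨c, hcm, fun ξ => ?_, ?_⟩
  · rw [← Finset.powerset_univ, ← hF, Fin.sort_univ]
  · rw [htop, Finset.card_univ, Fintype.card_fin]

/-! ### G-holomorphy of the Fourier transform -/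

/-- `G u` moves left through the components up to a sign and joins the coefficient. This handles one
factor of `w(-ξ)`. -/
theorem GHol.mul_one_sub_G_mul_component {F : T.PhaseEven → T.Env} (hF : F ∈ T.GHol T.GAR)
    (u : H) (w : T.QH) : (fun ξ => F ξ * (1 - T.G u * T.component w ξ)) ∈ T.GHol T.GAR := by
  have h : (fun ξ => F ξ * (T.G u * T.component w ξ)) ∈ T.GHol T.GAR := by
    induction hF using Submodule.span_induction with
    | mem F hF =>
      obtain ⟨X, hX, l, rfl⟩ := hF
      have e : (fun ξ => X * (l.map fun u => T.component u ξ).prod * (T.G u * T.component w ξ)) =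
          (-1 : ℂ) ^ l.length • fun ξ =>
            X * T.G u * ((l ++ [w]).map fun u => T.component u ξ).prod := by
        ext ξ
        rw [mul_assoc, ← mul_assoc _ (T.G u), list_prod_component_mul l ξ fun a ha => ha.mul_G u]
        simp [mul_assoc]
      rw [e]
      exact Submodule.smul_mem _ _ (Submodule.subset_span
        ⟨X * T.G u, mul_mem hX (G_mem_GAR u), l ++ [w], rfl⟩)
    | zero => convert Submodule.zero_mem (T.GHol T.GAR) using 1; ext; simp
    | add F F' _ _ hF hF' => convert add_mem hF hF' using 1; ext; simp [add_mul]
    | smul c F _ hF => convert Submodule.smul_mem _ c hF using 1; ext; simp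
  convert sub_mem hF h using 1
  ext ξ
  simp [mul_sub]

theorem mul_weyl_neg_mem_GHol (e : OrthonormalBasis (Fin m) ℂ T.QH) (he : ∀ i, T.JQ (e i) = e i)
    {A : T.Env} (hA : A ∈ T.GAR) : (fun ξ => A * T.weyl (-ξ)) ∈ T.GHol T.GAR := by
  have key : ∀ (l : List (Fin m)) (F : T.PhaseEven → T.Env), F ∈ T.GHol T.GAR →
      (fun ξ => F ξ * (l.map fun i => 1 - T.G (e i) * T.component (e i) ξ).prod) ∈
        T.GHol T.GAR := fun l => by
    induction l with
    | nil => intro F hF; simpa using hF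
    | cons i l ih =>
      intro F hF
      simpa [mul_assoc] using ih _ (GHol.mul_one_sub_G_mul_component hF (e i) (e i))
  simp only [weyl_neg_eq_prod e he]
  exact key _ (fun _ => A) (Submodule.subset_span ⟨A, hA, [], by simp⟩)

theorem GHol.map {E E' : Subalgebra ℂ T.Env} {φ : Module.End ℂ T.Env} {σ : ℂ}
    (hφ : ∀ X a, T.IsOddGr a → φ (X * a) = σ • (φ X * a)) (hE : ∀ X ∈ E, φ X ∈ E')
    {F : T.PhaseEven → T.Env} (hF : F ∈ T.GHol E) : (fun ξ => φ (F ξ)) ∈ T.GHol E' := by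
  induction hF using Submodule.span_induction with
  | mem F hF =>
    obtain ⟨X, hX, l, rfl⟩ := hF
    simp only [map_mul_list_prod_component hφ]
    exact Submodule.smul_mem (T.GHol E') (σ ^ l.length)
      (Submodule.subset_span ⟨φ X, hE X hX, l, rfl⟩)
  | zero => convert Submodule.zero_mem (T.GHol E') using 1; ext; simp
  | add F F' _ _ hF hF' => convert add_mem hF hF' using 1; ext; simp
  | smul c F _ hF => convert Submodule.smul_mem _ c hF using 1; ext; simp

theorem twists_basis_mem_Gr (e : OrthonormalBasis (Fin m) ℂ T.QH) (he : ∀ i, T.JQ (e i) = e i)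
    {X : T.Env} (hX : X ∈ T.GAR) :
    T.twists ((List.finRange m).map fun i => (e i : H)) X ∈ T.Gr := by
  refine twists_mem_Gr ?_ ?_ hX
  · rw [List.pairwise_map]
    refine (List.nodup_finRange m).imp fun {i j} hij => ?_
    rw [show T.J (e i : H) = e i from congrArg Subtype.val (he i), T.Q_of_mem (e j).2]
    exact e.orthonormal.2 hij
  · intro x hx
    have h := congrArg Subtype.val (e.sum_repr' ⟨x, hx⟩)
    rw [← show _ = x from h, Submodule.coe_sum]
    refine Submodule.sum_mem _ fun i _ => Submodule.smul_mem _ _ (Submodule.subset_span ?_)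
    exact List.mem_map.2 ⟨i, List.mem_finRange i, rfl⟩

theorem grassmannIntegral_eq {E : Subalgebra ℂ T.Env} {v : ExteriorAlgebra ℂ T.QH}
    {F : T.PhaseEven → T.Env} (hF : T.GrassmannIntegrable E v F) {X : T.Env}
    (hX : T.IsIntegralValue E v F X) : T.grassmannIntegral E v F = X := by
  have h : ∃ X, T.IsIntegralValue E v F X := ⟨X, hX⟩
  rw [grassmannIntegral, dif_pos h]
  exact hF.2.unique h.choose_spec hX

end GARTriple

end

/-! ### Fourier inversion -/

theorem mainTheorem3 {H : Type*} [NormedAddCommGroup H] [InnerProductSpace ℂ H] [CompleteSpace H]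
    [TopologicalSpace.SeparableSpace H] (T : GARTriple H) (n : ℕ)
    [FiniteDimensional ℂ T.QH] (hrank : Module.finrank ℂ T.QH = 2 * n)
    (hperp : ¬ FiniteDimensional ℂ T.QperpH)
    (v : ExteriorAlgebra ℂ T.QH) (hv : T.IsTopForm v) (hv_adj : T.formStar v = v)
    (hv_norm : T.formInner v v = 1) (A : T.Env) (hA : A ∈ T.GAR) :
    (∀ ξ, T.GrassmannIntegrable T.GAR v (T.fourierIntegrand A ξ)) ∧
    T.fourier v A ∈ T.GHol T.Gr ∧
    (∀ ξ, T.fourier v A ξ ∈ T.Gr) ∧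
    T.GrassmannIntegrable T.GAR v (fun ξ => T.weyl ξ * T.fourier v A ξ) ∧
    A = T.grassmannIntegral T.GAR v (fun ξ => T.weyl ξ * T.fourier v A ξ) := by
  obtain ⟨m, e, he⟩ := T.exists_real_orthonormalBasis
  obtain rfl : m = 2 * n := by
    rw [← hrank, Module.finrank_eq_card_basis e.toBasis, Fintype.card_fin]
  obtain ⟨r, hr⟩ := hv.exists_eq_smul e
  have hrr := GARTriple.sq_eq_of_selfadjoint_of_normalized hv_adj hv_norm e he hr
  -- An expansion in the single basis `e` suffices: independence of basis and representation is
  -- `IsIntegralValue.unique`.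
  have integrable : ∀ (F : T.PhaseEven → T.Env) (c : Finset (Fin (2 * n)) → T.Env), 
      (∀ K, c K ∈ T.GAR) → (∀ ξ, F ξ = ∑ K, c K * T.monomial e K ξ) →
      T.GrassmannIntegrable T.GAR v F ∧ T.IsIntegralValue T.GAR v F (r • c Finset.univ) :=
    fun F c hc hF => by
      have hval : T.IsIntegralValue T.GAR v F (r • c Finset.univ) :=
        ⟨_, e, c, r, he, hc, hF, hr, rfl⟩
      refine ⟨⟨?_, _, hval, fun Y hY => hY.unique hrank hperp hv_adj hv_norm hval⟩, hval⟩
      rw [show F = fun ξ => ∑ K, c K * T.monomial e K ξ from funext hF]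
      exact GARTriple.monomial_sum_mem_GHol e hc
  have h1 : ∀ ξ, T.GrassmannIntegrable T.GAR v (T.fourierIntegrand A ξ) ∧
      T.grassmannIntegral T.GAR v (T.fourierIntegrand A ξ) = r • ((List.finRange (2 * n)).map
        fun i => T.shiftedTwist (e i) (T.component (e i) ξ)).prod A := fun ξ => by
    obtain ⟨c, hc, hF, htop⟩ := GARTriple.exists_fourierIntegrand_expansion e he hA ξ
    obtain ⟨h, hval⟩ := integrable _ c hc hF
    exact ⟨h, by rw [GARTriple.grassmannIntegral_eq h hval, htop]⟩
  have hmem : ∀ ξ, T.twists ((List.finRange (2 * n)).map fun i => (e i : H))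
      (A * T.weyl (-ξ)) ∈ T.Gr := fun ξ => by
    refine GARTriple.twists_basis_mem_Gr e he (mul_mem hA ?_)
    rw [GARTriple.weyl_neg_eq_prod e he]
    refine list_prod_mem fun x hx => ?_
    obtain ⟨i, -, rfl⟩ := List.mem_map.1 hx
    exact sub_mem (one_mem _) (mul_mem (GARTriple.G_mem_GAR _)
      (GARTriple.isOddGr_component _ _).mem_GAR)
  have h2 : T.fourier v A = fun ξ => r • T.twists ((List.finRange (2 * n)).map
      fun i => (e i : H)) (A * T.weyl (-ξ)) := by
    ext ξ
    -- Insert `1 = w(-ξ) w(ξ)` on the right: the first factor removes the shifts, and the second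
    -- commutes with the resulting element of `Gr` and cancels the prefactor `w(-ξ)`.
    rw [GARTriple.fourier, (h1 ξ).2, mul_smul_comm, ← mul_one (DFunLike.coe (List.prod _) A),
      ← GARTriple.weyl_neg_mul_weyl ξ, ← mul_assoc (DFunLike.coe (List.prod _) A),
      GARTriple.prod_shiftedTwist_mul_weyl_neg e he,
      (GARTriple.commute_weyl_of_mem_Gr e (hmem ξ) ξ).eq, ← mul_assoc,
      GARTriple.weyl_neg_mul_weyl, one_mul]
  have h3 : T.fourier v A ∈ T.GHol T.Gr := by
    rw [h2]
    exact Submodule.smul_mem _ r (GARTriple.GHol.map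
      (fun X a ha => GARTriple.twists_mul_isOddGr _ X ha)
      (fun X hX => GARTriple.twists_basis_mem_Gr e he hX)
      (GARTriple.mul_weyl_neg_mem_GHol e he hA))
  have h4 : ∀ ξ, T.weyl ξ * T.fourier v A ξ = r • ((List.finRange (2 * n)).map
      fun i => T.shiftedTwist (e i) (T.component (e i) ξ)).prod A := fun ξ => by
    rw [GARTriple.fourier, (h1 ξ).2, ← mul_assoc, GARTriple.weyl_mul_weyl_neg, one_mul]
  obtain ⟨c, hc, hF, htop⟩ := GARTriple.exists_inverse_expansion e hA
  obtain ⟨h5, hval⟩ := integrable (fun ξ => T.weyl ξ * T.fourier v A ξ) (fun K => r • c K)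
    (fun K => Subalgebra.smul_mem _ (hc K) r)
    (fun ξ => by rw [h4, hF, Finset.smul_sum]; simp only [smul_mul_assoc])
  refine ⟨fun ξ => (h1 ξ).1, h3, fun ξ => ?_, h5, ?_⟩
  · rw [h2]
    exact Subalgebra.smul_mem _ (hmem ξ) r
  -- The constants are `r * r = (-1)^n`, `(-1)^(2n) = 1` and the reordering sign `(-1)^n`; their
  -- product is `1`.
  · rw [GARTriple.grassmannIntegral_eq h5 hval, htop, neg_one_pow_sum_range_two_mul, smul_smul,
      smul_smul, hrr, pow_mul, neg_one_sq, one_pow, one_mul, ← mul_pow, neg_one_mul, neg_neg,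
      one_pow, one_smul]
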